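/- Work on the triangular lattice drawn so that one family of lattice lines is horizontal. A lozenge is the union of two unit triangles sharing an edge; a lozenge tiling of a lattice region is a covering of it by lozenges without gaps or overlaps. For a centrally symmetric region $R$, let $M_\odot(R)$ be the number of lozenge tilings of $R$ that are invariant under the rotation by $180^\circ$ about its center. Put $h(n)=0!\,1!\cdots(n-1)!$. For non-negative integers $b_1,\dots,b_l$, let $s(b_1,\dots,b_l)$ be the number of lozenge tilings of the trapezoid with bottom side of length $b_1+\cdots+b_l$, lateral sides of length $b_1+b_3+b_5+\cdots$ and top side of length $b_2+b_4+\cdots$, from which the leftmost $b_1$ up-pointing unit triangles along the bottom side are removed, the next $b_2$ are kept, the following $b_3$ are removed, and so on. For non-negative integers $a_1,\dots,a_k$ the fern $F(a_1,\dots,a_k)$ is the string of lattice triangles of sizes $a_1,\dots,a_k$, from left to right, lined up along a horizontal lattice line, touching at their vertices, alternately pointing up and down, the leftmost one pointing up; its base point is its leftmost point. Let $x\ge -1$, $y\ge 0$, $z\ge 0$ be integers of the same parity, let $k\ge1$, let $a_1,\dots,a_k$ be non-negative integers, and put $a=a_1+\cdots+a_k$. Let $H$ be the lattice hexagon of side-lengths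 $x+a+1,\ y+a,\ z+a,\ x+a+1,\ y+a,\ z+a$ (clockwise from top). Let $O$ be the center of the hexagon $\bar H$ of side-lengths $x,y,z,x,y,z$ (clockwise from top) that shares the western corner $W$ of $H$; that is, $O=W+\frac12\left(x\,e_0+y\,e_{-\pi/3}+z\,e_{\pi/3}\right)$, where $e_\theta$ is the unit vector in the polar direction $\theta$ (this is the definition of $O$ also when $x=-1$); $O$ is a lattice point. Let $FC'_{x,y,z}(a_1,\dots,a_k,a_k,\dots,a_1)$ be the region obtained from $H$ by removing the fern $F(a_1,\dots,a_k)$ with base point $O$ and the image of this fern under the rotation by $180^\circ$ about the center of $H$ (the two removed ferns are separated by a unit lattice segment centered at the center of $H$). Let $c_1,\dots,c_{2k}$ be the sequence obtained from $a_1,\dots,a_k,a_k,\dots,a_1$ by adding $1$ to its $(k+1)$-st entry if $k$ is odd, and to its $k$-th entry if $k$ is even. Then $M_\odot\big(FC'_{x,y,z}(a,a)\big)>0$ and $$ \frac{M_\odot\big(FC'_{x,y,z}(a_1,\dots,a_k,a_k,\dots,a_1)\big)}{M_\odot\big(FC'_{x,y,z}(a,a)\big)} = s(a_1,\dots,a_{k-1},a_k+1,a_k,\dots,a_1)\,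 \frac{h(\frac{x+z}{2}+a)}{h(\frac{x+y}{2}+a)} \prod_{1\le 2i+1\le 2k}\frac{h(\frac{x+y}{2}+c_1+\cdots+c_{2i+1})}{h(\frac{x+z}{2}+c_1+\cdots+c_{2i+1})} \prod_{1<2i<2k}\frac{h(\frac{x+z}{2}+c_1+\cdots+c_{2i})}{h(\frac{x+y}{2}+c_1+\cdots+c_{2i})}. $$ -/

import Mathlib

namespace FernCored

/-! Lattice points of the triangular lattice are pairs `(u, v) : ℤ × ℤ`, standing for the point
`u + v * exp (π * I / 3)` of the plane; the lines `v = const` are the horizontal lattice lines. -/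

/-- The unit triangles of the lattice. The up-pointing triangle `⟨i, j, true⟩` has vertices
`(i, j)`, `(i + 1, j)`, `(i, j + 1)`; the down-pointing triangle `⟨i, j, false⟩` has vertices
`(i + 1, j)`, `(i, j + 1)`, `(i + 1, j + 1)`. -/
structure UnitTriangle where
  i : ℤ
  j : ℤ
  up : Bool
deriving DecidableEq

/-- The three vertices of a unit triangle. -/
def UnitTriangle.vertices (t : UnitTriangle) : Finset (ℤ × ℤ) :=
  if t.up then {(t.i, t.j), (t.i + 1, t.j), (t.i, t.j + 1)}
  else {(t.i + 1, t.j), (t.i, t.j + 1), (t.i + 1, t.j + 1)}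

/-- Two unit triangles share an edge (that is, exactly two vertices). -/
def UnitTriangle.Adjacent (s t : UnitTriangle) : Prop :=
  (s.vertices ∩ t.vertices).card = 2

/-- A lozenge: the union of two unit triangles that share an edge. -/
def IsLozenge (L : Finset UnitTriangle) : Prop :=
  ∃ s t : UnitTriangle, s.Adjacent t ∧ L = {s, t}

/-- `T` is a lozenge tiling of the lattice region `R` (a set of unit triangles): a set of lozenges
contained in `R` such that every unit triangle of `R` is covered exactly once. -/
def IsTiling (R : Set UnitTriangle) (T : Set (Finset UnitTriangle)) : Prop :=
  (∀ L ∈ T, IsLozenge L ∧ (L : Set UnitTriangle) ⊆ R) ∧ ∀ t ∈ R, ∃! L, L ∈ T ∧ t ∈ L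

/-- The number `M(R)` of lozenge tilings of `R`. -/
noncomputable def numTilings (R : Set UnitTriangle) : ℕ :=
  {T : Set (Finset UnitTriangle) | IsTiling R T}.ncard

/-- The image of a unit triangle under the reflection `p ↦ c - p` across the point `c / 2`. -/
def UnitTriangle.rotate (c : ℤ × ℤ) (t : UnitTriangle) : UnitTriangle :=
  ⟨c.1 - t.i - 1, c.2 - t.j - 1, !t.up⟩

theorem UnitTriangle.vertices_rotate (c : ℤ × ℤ) (t : UnitTriangle) :
    (t.rotate c).vertices = t.vertices.image (fun p => c - p) := by
  obtain ⟨i, j, b⟩ := t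
  obtain ⟨c₁, c₂⟩ := c
  cases b <;> ext ⟨u, v⟩ <;> simp [UnitTriangle.rotate, UnitTriangle.vertices] <;> omega

/-- The number `M_⊙(R)` of lozenge tilings of `R` that are invariant under the reflection
`p ↦ c - p` across the center `c / 2` of `R`. -/
noncomputable def numSymmTilings (c : ℤ × ℤ) (R : Set UnitTriangle) : ℕ :=
  {T : Set (Finset UnitTriangle) |
    IsTiling R T ∧ ∀ L ∈ T, L.image (UnitTriangle.rotate c) ∈ T}.ncard

/-- The unit triangles contained in the convex lattice polygon with set of lattice points `P`. -/
def trianglesIn (P : Set (ℤ × ℤ)) : Set UnitTriangle :=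
  {t | ∀ p ∈ t.vertices, p ∈ P}

/-- The hexagon of side-lengths `A, B, C, A, B, C` (clockwise from top) with western corner at
`(0, 0)`. Its other corners are, clockwise, `(0, C)`, `(A, C)`, `(A + B, C - B)`,
`(A + B, -B)`, `(B, -B)`. -/
def hexagon (A B C : ℤ) : Set UnitTriangle :=
  trianglesIn {p | 0 ≤ p.1 ∧ p.1 ≤ A + B ∧ -B ≤ p.2 ∧ p.2 ≤ C ∧ 0 ≤ p.1 + p.2 ∧ p.1 + p.2 ≤ A + C}

/-- The lattice triangle of size `n` whose horizontal side has left endpoint `b`, lying above that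
side (pointing up) if `up` is true, and below it (pointing down) otherwise. -/
def bigTriangle (b : ℤ × ℤ) (n : ℕ) (up : Bool) : Set UnitTriangle :=
  trianglesIn <|
    if up then {p | b.1 ≤ p.1 ∧ b.2 ≤ p.2 ∧ p.1 + p.2 ≤ b.1 + b.2 + n}
    else {p | p.1 ≤ b.1 + n ∧ p.2 ≤ b.2 ∧ b.1 + b.2 ≤ p.1 + p.2}

/-- A string of lattice triangles of the given sizes, alternating in orientation, lined up along the
horizontal line through the base point `b`, starting at `b` with orientation `up`. -/
def lobes (b : ℤ × ℤ) (up : Bool) : List ℕ → Set UnitTriangle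
  | [] => ∅
  | n :: l => bigTriangle b n up ∪ lobes (b.1 + n, b.2) (!up) l

/-- The fern `F(a_1, …, a_k)` with base point `b`; its leftmost lobe points up. -/
def fern (b : ℤ × ℤ) (a : List ℕ) : Set UnitTriangle :=
  lobes b true a

/-- Twice the center of the hexagon `hexagon A B C`. -/
def twiceCenter (A B C : ℤ) : ℤ × ℤ :=
  (A + B, C - B)

/-- Twice the center of the hexagon of side-lengths
`x + a + 1, y + a, z + a, x + a + 1, y + a, z + a`, where `a = a_1 + ⋯ + a_k`. -/
def fcCenter (x y z : ℤ) (a : List ℕ) : ℤ × ℤ :=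
  twiceCenter (x + a.sum + 1) (y + a.sum) (z + a.sum)

/-- The left one of the two removed ferns: `F(a_1, …, a_k)` with its base point at the center of the
auxiliary hexagon, which has side-lengths `x, y, z, x, y, z` and shares the western corner of the
outer hexagon. (The divisions are exact when `x`, `y`, `z` have the same parity.) -/
def leftFern (x y z : ℤ) (a : List ℕ) : Set UnitTriangle :=
  fern ((twiceCenter x y z).1 / 2, (twiceCenter x y z).2 / 2) a

/-- The region `FC'_{x,y,z}(a_1, …, a_k, a_k, …, a_1)`: the hexagon of side-lengths
`x + a + 1, y + a, z + a, x + a + 1, y + a, z + a` with the left fern and its image across the center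
of the hexagon removed. -/
def fcRegion (x y z : ℤ) (a : List ℕ) : Set UnitTriangle :=
  hexagon (x + a.sum + 1) (y + a.sum) (z + a.sum) \
    (leftFern x y z a ∪ UnitTriangle.rotate (fcCenter x y z a) '' leftFern x y z a)

/-- `M_⊙(FC'_{x,y,z}(a_1, …, a_k, a_k, …, a_1))`. -/
noncomputable def fcCount (x y z : ℤ) (a : List ℕ) : ℕ :=
  numSymmTilings (fcCenter x y z a) (fcRegion x y z a)

/-- `b_1 + b_3 + b_5 + ⋯`. -/
def oddSum : List ℕ → ℕ
  | [] => 0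
  | [n] => n
  | n :: _ :: l => n + oddSum l

/-- The up-pointing unit triangles along the line `v = 0`, starting at `(p, 0)`: the first `b_1` are
selected, the next `b_2` are not, the following `b_3` are selected, and so on. -/
def baseTriangles (p : ℤ) : List ℕ → Set UnitTriangle
  | [] => ∅
  | [n] => {t | t.up = true ∧ t.j = 0 ∧ p ≤ t.i ∧ t.i < p + n}
  | n :: m :: l =>
      {t | t.up = true ∧ t.j = 0 ∧ p ≤ t.i ∧ t.i < p + n} ∪ baseTriangles (p + n + m) l

/-- The region `S(b_1, …, b_l)`: the trapezoid with horizontal base of length `b_1 + ⋯ + b_l`, lateral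
sides (making angles of `π / 3` with the base) of length `b_1 + b_3 + ⋯` and top side of length
`b_2 + b_4 + ⋯`, with the leftmost `b_1` up-pointing unit triangles along its base removed, the next
`b_2` kept, the following `b_3` removed, and so on. -/
def semihexagon (b : List ℕ) : Set UnitTriangle :=
  trianglesIn {p | 0 ≤ p.1 ∧ 0 ≤ p.2 ∧ p.2 ≤ oddSum b ∧ p.1 + p.2 ≤ b.sum} \ baseTriangles 0 b

/-- `s(b_1, …, b_l)`: the number of lozenge tilings of `S(b_1, …, b_l)`. -/
noncomputable def semihexagonCount (b : List ℕ) : ℕ :=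
  numTilings (semihexagon b)

/-- The hyperfactorial `h(n) = 0! 1! ⋯ (n-1)!`. -/
def hyperfact (n : ℕ) : ℕ :=
  ∏ i ∈ Finset.range n, i.factorial

/-- The list `a_1, …, a_k, a_k, …, a_1`. -/
def doubled (a : List ℕ) : List ℕ :=
  a ++ a.reverse

/-- The list `a_1, …, a_{k-1}, a_k + 1, a_k, …, a_1`. -/
def semihexagonArgs (a : List ℕ) : List ℕ :=
  (doubled a).modify (a.length - 1) (· + 1)

/-- The list `c_1, …, c_{2k}` obtained from `a_1, …, a_k, a_k, …, a_1` by adding `1` to its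
`(k+1)`-st entry if `k` is odd, and to its `k`-th entry if `k` is even. -/
def gappedLobes (a : List ℕ) : List ℕ :=
  (doubled a).modify (if Odd a.length then a.length else a.length - 1) (· + 1)

/-- The partial sum `c_1 + ⋯ + c_j` of `gappedLobes a`. -/
def gappedSum (a : List ℕ) (j : ℕ) : ℕ :=
  ((gappedLobes a).take j).sum

end FernCored

open FernCored

/-! Write `x = 2m - y` and `z = y + 2h`, and let `s` be the sum of the list `a`. The horizontal line
through the centre of the hexagon is then `v = h`, both ferns lie along it, and the unit segment
separating them sits at position `m + s`. A position `p` denotes the unit segment from `p` to `p +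
1`; the rotation acts on positions by `p ↦ 2m + 2s - p`.

A centrally symmetric tiling is determined by the symmetric set `X` of positions where lozenges
cross the axis, together with a tiling of the rest of the upper half (`numSymmTilings_eq_sum`).
Adding an up-pointing triangle of size `|h|` at one end turns the upper half of the hexagon into a
trapezoid. Removing an up-pointing triangle standing on the base amounts to removing only the unit
triangles along its own base (`numTilings_diff_bigTriangle`). So the upper half becomes a trapezoid
with dents at `X ∪ E ∪ U`, where `E` is the added segment and `U` the set of bases of all
up-pointing lobes of the two ferns.

By the Cohn–Larsen–Propp formula (`numTilings_trapezoid_mul_hyperfact`) the tilings of this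
trapezoid are counted, up to a hyperfactorial, by the product of the differences of the dents. That
product splits into parts internal to `X ∪ E` and to `U`, and into the distances from `U` to `X` and
to `E`. Since `X` is symmetric, and `U` and its mirror image partition the positions covered by the
ferns, the square of the product of distances from `X` to `U` depends on `s` only
(`crossDist_eq_of_symm`). Hence the sum over `X` is a common factor (`fcCount_mul_hyperfact`), which
is nonzero and cancels in the quotient.

What remains is the ratio of the internal products, which is the semihexagon count
(`vand_upPositions`), and the ratio of the distances to `E`, which telescopes to the hyperfactorials
(`crossDist_ext`). -/

namespace FernCored

/-! ### Adjacency of unit triangles -/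

/-- The unit triangles sharing an edge with a given one. -/
def UnitTriangle.nbrs (t : UnitTriangle) : Finset UnitTriangle :=
  if t.up then {⟨t.i, t.j, false⟩, ⟨t.i - 1, t.j, false⟩, ⟨t.i, t.j - 1, false⟩}
  else {⟨t.i, t.j, true⟩, ⟨t.i + 1, t.j, true⟩, ⟨t.i, t.j + 1, true⟩}

@[simp] theorem mem_nbrs_up {s : UnitTriangle} {i j : ℤ} :
    s ∈ UnitTriangle.nbrs ⟨i, j, true⟩ ↔
      s = ⟨i, j, false⟩ ∨ s = ⟨i - 1, j, false⟩ ∨ s = ⟨i, j - 1, false⟩ := by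
  simp [UnitTriangle.nbrs]

@[simp] theorem mem_nbrs_down {s : UnitTriangle} {i j : ℤ} :
    s ∈ UnitTriangle.nbrs ⟨i, j, false⟩ ↔
      s = ⟨i, j, true⟩ ∨ s = ⟨i + 1, j, true⟩ ∨ s = ⟨i, j + 1, true⟩ := by
  simp [UnitTriangle.nbrs]

/-- Recasts the cardinality condition in integer coordinates, so that adjacency can be settled by
linear arithmetic. -/
theorem exists_two_common {s t : UnitTriangle} (h : s.Adjacent t) :
    ∃ a b c d : ℤ, (a ≠ c ∨ b ≠ d) ∧ (a, b) ∈ s.vertices ∧ (a, b) ∈ t.vertices ∧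
      (c, d) ∈ s.vertices ∧ (c, d) ∈ t.vertices ∧
      ∀ e f, (e, f) ∈ s.vertices → (e, f) ∉ t.vertices ∨ (e = a ∧ f = b) ∨ (e = c ∧ f = d) := by
  obtain ⟨⟨a, b⟩, ⟨c, d⟩, hne, heq⟩ := Finset.card_eq_two.1 h
  have key : ∀ p, p ∈ s.vertices ∧ p ∈ t.vertices ↔ p = (a, b) ∨ p = (c, d) := by
    intro p
    rw [← Finset.mem_inter, heq]
    simp
  refine ⟨a, b, c, d, ?_, ((key _).2 (Or.inl rfl)).1, ((key _).2 (Or.inl rfl)).2,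
    ((key _).2 (Or.inr rfl)).1, ((key _).2 (Or.inr rfl)).2, fun e f h1 => ?_⟩
  · by_contra hc
    push Not at hc
    exact hne (by rw [hc.1, hc.2])
  · by_cases h2 : (e, f) ∈ t.vertices
    · exact Or.inr (by simpa using (key _).1 ⟨h1, h2⟩)
    · exact Or.inl h2

theorem adjacent_of_inter_eq {s t : UnitTriangle} {p q : ℤ × ℤ} (hpq : p ≠ q)
    (h : ∀ r, r ∈ s.vertices ∧ r ∈ t.vertices ↔ r = p ∨ r = q) : s.Adjacent t := by
  have : s.vertices ∩ t.vertices = {p, q} := by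
    ext r
    rw [Finset.mem_inter, h]
    simp
  rw [UnitTriangle.Adjacent, this, Finset.card_pair hpq]

/-- Two triangles of the same orientation with two common vertices coincide, and then share a third
vertex, which is excluded. For opposite orientations the common edge leaves exactly three
possibilities. -/
theorem adjacent_iff_mem_nbrs (s t : UnitTriangle) : s.Adjacent t ↔ s ∈ t.nbrs := by
  obtain ⟨i, j, b⟩ := s
  obtain ⟨k, l, b'⟩ := t
  constructor
  · intro h
    obtain ⟨p, q, r, w, hne, h1, h2, h3, h4, h5⟩ := exists_two_common h
    cases b <;> cases b'
    · have e1 := h5 (i + 1) j (by simp [UnitTriangle.vertices])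
      have e2 := h5 i (j + 1) (by simp [UnitTriangle.vertices])
      have e3 := h5 (i + 1) (j + 1) (by simp [UnitTriangle.vertices])
      clear h5
      simp [UnitTriangle.vertices] at h1 h2 h3 h4 e1 e2 e3 ⊢
      obtain ⟨rfl, rfl⟩ : i = k ∧ j = l := by
        clear e1 e2 e3
        rcases h1 with ⟨rfl, rfl⟩ | ⟨rfl, rfl⟩ | ⟨rfl, rfl⟩ <;>
          rcases h3 with ⟨rfl, rfl⟩ | ⟨rfl, rfl⟩ | ⟨rfl, rfl⟩ <;> omega
      omega
    · clear h5
      simp [UnitTriangle.vertices] at h1 h2 h3 h4 ⊢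
      rcases h1 with ⟨rfl, rfl⟩ | ⟨rfl, rfl⟩ | ⟨rfl, rfl⟩ <;>
        rcases h3 with ⟨rfl, rfl⟩ | ⟨rfl, rfl⟩ | ⟨rfl, rfl⟩ <;> omega
    · clear h5
      simp [UnitTriangle.vertices] at h1 h2 h3 h4 ⊢
      rcases h1 with ⟨rfl, rfl⟩ | ⟨rfl, rfl⟩ | ⟨rfl, rfl⟩ <;>
        rcases h3 with ⟨rfl, rfl⟩ | ⟨rfl, rfl⟩ | ⟨rfl, rfl⟩ <;> omega
    · have e1 := h5 (i + 1) j (by simp [UnitTriangle.vertices])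
      have e2 := h5 i (j + 1) (by simp [UnitTriangle.vertices])
      have e3 := h5 i j (by simp [UnitTriangle.vertices])
      clear h5
      simp [UnitTriangle.vertices] at h1 h2 h3 h4 e1 e2 e3 ⊢
      obtain ⟨rfl, rfl⟩ : i = k ∧ j = l := by
        clear e1 e2 e3
        rcases h1 with ⟨rfl, rfl⟩ | ⟨rfl, rfl⟩ | ⟨rfl, rfl⟩ <;>
          rcases h3 with ⟨rfl, rfl⟩ | ⟨rfl, rfl⟩ | ⟨rfl, rfl⟩ <;> omega
      omega
  · intro h
    cases b <;> cases b' <;> simp at h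
    · rcases h with h | h | h <;> obtain ⟨rfl, rfl⟩ := h
      · apply adjacent_of_inter_eq (p := (i + 1, j)) (q := (i, j + 1)) (by simp)
        rintro ⟨u, v⟩
        simp [UnitTriangle.vertices]
        omega
      · apply adjacent_of_inter_eq (p := (k, j)) (q := (k, j + 1)) (by simp)
        rintro ⟨u, v⟩
        simp [UnitTriangle.vertices]
        omega
      · apply adjacent_of_inter_eq (p := (i, l)) (q := (i + 1, l)) (by simp)
        rintro ⟨u, v⟩
        simp [UnitTriangle.vertices]
        omega
    · rcases h with h | h | h <;> obtain ⟨rfl, rfl⟩ := h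
      · apply adjacent_of_inter_eq (p := (i + 1, j)) (q := (i, j + 1)) (by simp)
        rintro ⟨u, v⟩
        simp [UnitTriangle.vertices]
        omega
      · apply adjacent_of_inter_eq (p := (k + 1, j)) (q := (k + 1, j + 1)) (by simp)
        rintro ⟨u, v⟩
        simp [UnitTriangle.vertices]
        omega
      · apply adjacent_of_inter_eq (p := (i, l + 1)) (q := (i + 1, l + 1)) (by simp)
        rintro ⟨u, v⟩
        simp [UnitTriangle.vertices]
        omega

theorem nbrs_symm {s t : UnitTriangle} (h : s ∈ t.nbrs) : t ∈ s.nbrs := by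
  rw [← adjacent_iff_mem_nbrs] at h ⊢
  rwa [UnitTriangle.Adjacent, Finset.inter_comm]

theorem up_of_mem_nbrs {s t : UnitTriangle} (h : s ∈ t.nbrs) : s.up = !t.up := by
  obtain ⟨i, j, b⟩ := t
  cases b <;> simp at h <;> rcases h with rfl | rfl | rfl <;> rfl

theorem ne_of_mem_nbrs {s t : UnitTriangle} (h : s ∈ t.nbrs) : s ≠ t := by
  rintro rfl
  simpa using up_of_mem_nbrs h

theorem isLozenge_pair {s t : UnitTriangle} (h : s ∈ t.nbrs) : IsLozenge {t, s} :=
  ⟨t, s, (adjacent_iff_mem_nbrs _ _).2 (nbrs_symm h), rfl⟩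

theorem IsLozenge.exists_eq_pair {L : Finset UnitTriangle} (hL : IsLozenge L) {t : UnitTriangle}
    (ht : t ∈ L) : ∃ s ∈ t.nbrs, L = {t, s} := by
  obtain ⟨a, b, hab, rfl⟩ := hL
  rw [adjacent_iff_mem_nbrs] at hab
  simp only [Finset.mem_insert, Finset.mem_singleton] at ht
  rcases ht with rfl | rfl
  · exact ⟨b, nbrs_symm hab, rfl⟩
  · exact ⟨a, hab, Finset.pair_comm _ _⟩

/-! ### Recursion for the number of tilings -/

theorem IsTiling.eq_of_mem {R : Set UnitTriangle} {T : Set (Finset UnitTriangle)}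
    (hT : IsTiling R T) {L L' : Finset UnitTriangle} (hL : L ∈ T) (hL' : L' ∈ T)
    {t : UnitTriangle} (ht : t ∈ L) (ht' : t ∈ L') : L = L' :=
  (hT.2 t ((hT.1 L hL).2 ht)).unique ⟨hL, ht⟩ ⟨hL', ht'⟩

theorem finite_tilings {R : Set UnitTriangle} (hR : R.Finite) : {T | IsTiling R T}.Finite := by
  have h1 : {L : Finset UnitTriangle | (L : Set UnitTriangle) ⊆ R}.Finite := by
    refine (hR.toFinset.powerset.finite_toSet).subset fun L hL => ?_
    simp only [Finset.coe_powerset, Set.mem_preimage, Set.mem_powerset_iff, Set.Finite.coe_toFinset]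
    exact hL
  exact (h1.powerset).subset fun T hT L hL => (hT.1 L hL).2

theorem isTiling_diff_pair {R : Set UnitTriangle} {T : Set (Finset UnitTriangle)}
    (hT : IsTiling R T) {s t : UnitTriangle} (h : {t, s} ∈ T) :
    IsTiling (R \ {t, s}) (T \ {{t, s}}) := by
  refine ⟨fun L hL => ⟨(hT.1 L hL.1).1, fun u hu => ⟨(hT.1 L hL.1).2 hu, fun hu' => hL.2 ?_⟩⟩,
    fun u hu => ?_⟩
  · exact hT.eq_of_mem hL.1 h hu (by simpa using hu')
  · obtain ⟨L, hL, huniq⟩ := hT.2 u hu.1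
    refine ⟨L, ⟨⟨hL.1, ?_⟩, hL.2⟩, fun L' hL' => huniq L' ⟨hL'.1.1, hL'.2⟩⟩
    rintro rfl
    exact hu.2 (by simpa using hL.2)

theorem isTiling_insert_pair {R : Set UnitTriangle} {T : Set (Finset UnitTriangle)}
    {s t : UnitTriangle} (hs : s ∈ t.nbrs) (hsR : s ∈ R) (htR : t ∈ R)
    (hT : IsTiling (R \ {t, s}) T) : IsTiling R (insert {t, s} T) := by
  have hdis : ∀ L ∈ T, ∀ u ∈ L, u ≠ t ∧ u ≠ s := fun L hL u hu => by
    have := ((hT.1 L hL).2 hu).2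
    simpa using this
  refine ⟨?_, fun u hu => ?_⟩
  · rintro L (rfl | hL)
    · refine ⟨isLozenge_pair hs, ?_⟩
      intro u hu
      simp only [Finset.coe_insert, Finset.coe_singleton, Set.mem_insert_iff,
        Set.mem_singleton_iff] at hu
      rcases hu with rfl | rfl <;> assumption
    · exact ⟨(hT.1 L hL).1, (hT.1 L hL).2.trans Set.sdiff_subset⟩
  · by_cases h : u = t ∨ u = s
    · refine ⟨{t, s}, ⟨Set.mem_insert _ _, by simpa using h⟩, ?_⟩
      rintro L ⟨rfl | hL, hu'⟩
      · rfl
      · have := hdis L hL u hu'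
        tauto
    · obtain ⟨L, hL, huniq⟩ := hT.2 u ⟨hu, by simpa using h⟩
      refine ⟨L, ⟨Or.inr hL.1, hL.2⟩, ?_⟩
      rintro L' ⟨rfl | hL', hu'⟩
      · exact absurd (by simpa using hu') h
      · exact huniq L' ⟨hL', hu'⟩

/-- Deleting a fixed lozenge from a tiling and inserting it again are inverse bijections. -/
theorem ncard_tilings_containing {R : Set UnitTriangle} {s t : UnitTriangle}
    (hs : s ∈ t.nbrs) (hsR : s ∈ R) (htR : t ∈ R) :
    {T | IsTiling R T ∧ {t, s} ∈ T}.ncard = numTilings (R \ {t, s}) := by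
  refine Set.ncard_congr (fun T _ => T \ {{t, s}}) (fun T hT => isTiling_diff_pair hT.1 hT.2) ?_ ?_
  · intro T T' hT hT' h
    have := congrArg (insert ({t, s} : Finset UnitTriangle)) h
    simpa [Set.insert_eq_of_mem hT.2, Set.insert_eq_of_mem hT'.2] using this
  · intro T hT
    refine ⟨insert {t, s} T, ⟨isTiling_insert_pair hs hsR htR hT, Set.mem_insert _ _⟩, ?_⟩
    rw [Set.insert_sdiff_self_of_notMem]
    intro h
    exact ((hT.1 _ h).2 (show t ∈ _ by simp)).2 (by simp)

open Classical in
/-- Expansion of the number of tilings along the lozenge covering a given triangle. -/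
theorem numTilings_eq_sum_nbrs {R : Set UnitTriangle} (hR : R.Finite) {t : UnitTriangle}
    (ht : t ∈ R) :
    numTilings R = ∑ s ∈ t.nbrs with s ∈ R, numTilings (R \ {t, s}) := by
  have h1 : {T | IsTiling R T} =
      ⋃ s ∈ (({s ∈ t.nbrs | s ∈ R} : Finset UnitTriangle) : Set UnitTriangle),
        {T | IsTiling R T ∧ {t, s} ∈ T} := by
    ext T
    simp only [Set.mem_ofPred_eq, Finset.coe_filter, Set.mem_iUnion, exists_prop]
    refine ⟨fun hT => ?_, fun ⟨s, _, h⟩ => h.1⟩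
    obtain ⟨L, ⟨hL, htL⟩, _⟩ := hT.2 t ht
    obtain ⟨s, hs, rfl⟩ := (hT.1 L hL).1.exists_eq_pair htL
    exact ⟨s, ⟨hs, (hT.1 _ hL).2 (by simp)⟩, hT, hL⟩
  rw [numTilings, h1, Set.Finite.ncard_biUnion (Finset.finite_toSet _), finsum_mem_coe_finset]
  · refine Finset.sum_congr rfl fun s hs => ?_
    rw [Finset.mem_filter] at hs
    exact ncard_tilings_containing hs.1 hs.2 ht
  · exact fun s _ => (finite_tilings hR).subset fun T hT => hT.1
  · intro s hs s' hs' hne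
    simp only [Finset.coe_filter, Set.mem_ofPred_eq] at hs hs'
    refine Set.disjoint_left.2 fun T hT hT' => hne ?_
    have h2 := hT.1.eq_of_mem hT.2 hT'.2 (t := t) (by simp) (by simp)
    have h3 : s ∈ ({t, s'} : Finset UnitTriangle) := h2 ▸ (by simp)
    simp only [Finset.mem_insert, Finset.mem_singleton] at h3
    exact h3.resolve_left (ne_of_mem_nbrs hs.1)

theorem numTilings_eq_zero {R : Set UnitTriangle} (hR : R.Finite) {t : UnitTriangle}
    (ht : t ∈ R) (h : ∀ s ∈ t.nbrs, s ∉ R) : numTilings R = 0 := by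
  classical
  rw [numTilings_eq_sum_nbrs hR ht, Finset.filter_false_of_mem h, Finset.sum_empty]

/-- A triangle with only one neighbour in the region forces a lozenge. -/
theorem numTilings_forced {R : Set UnitTriangle} (hR : R.Finite) {s t : UnitTriangle}
    (ht : t ∈ R) (hs : s ∈ R) (hst : s ∈ t.nbrs) (h : ∀ u ∈ t.nbrs, u ∈ R → u = s) :
    numTilings R = numTilings (R \ {t, s}) := by
  classical
  have : ({u ∈ t.nbrs | u ∈ R} : Finset UnitTriangle) = {s} := by
    ext u
    simp only [Finset.mem_filter, Finset.mem_singleton]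
    exact ⟨fun hu => h u hu.1 hu.2, fun hu => hu ▸ ⟨hst, hs⟩⟩
  rw [numTilings_eq_sum_nbrs hR ht, this, Finset.sum_singleton]

theorem numTilings_branch {R : Set UnitTriangle} (hR : R.Finite) {s s' t : UnitTriangle}
    (ht : t ∈ R) (hs : s ∈ R) (hs' : s' ∈ R) (hst : s ∈ t.nbrs) (hst' : s' ∈ t.nbrs)
    (hne : s ≠ s') (h : ∀ u ∈ t.nbrs, u ∈ R → u = s ∨ u = s') :
    numTilings R = numTilings (R \ {t, s}) + numTilings (R \ {t, s'}) := by
  classical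
  have : ({u ∈ t.nbrs | u ∈ R} : Finset UnitTriangle) = {s, s'} := by
    ext u
    simp only [Finset.mem_filter, Finset.mem_singleton, Finset.mem_insert]
    refine ⟨fun hu => h u hu.1 hu.2, ?_⟩
    rintro (rfl | rfl)
    · exact ⟨hst, hs⟩
    · exact ⟨hst', hs'⟩
  rw [numTilings_eq_sum_nbrs hR ht, this, Finset.sum_pair hne]

theorem numTilings_empty : numTilings ∅ = 1 := by
  rw [numTilings, Set.ncard_eq_one]
  refine ⟨∅, ?_⟩
  ext T
  simp only [Set.mem_ofPred_eq, Set.mem_singleton_iff]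
  constructor
  · intro hT
    refine Set.eq_empty_of_forall_notMem fun L hL => ?_
    obtain ⟨hl, hL'⟩ := hT.1 L hL
    obtain ⟨s, t, _, rfl⟩ := hl
    exact hL' (show s ∈ _ by simp)
  · rintro rfl
    exact ⟨by simp, by simp⟩

/-- A tileable region has as many up-pointing as down-pointing triangles. -/
theorem ncard_up_eq_ncard_down {R : Set UnitTriangle} (hR : R.Finite) (h : numTilings R ≠ 0) :
    {t ∈ R | t.up = true}.ncard = {t ∈ R | t.up = false}.ncard := by
  classical
  induction hn : R.ncard using Nat.strong_induction_on generalizing R with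
  | _ n ih =>
    rcases R.eq_empty_or_nonempty with rfl | ⟨t, ht⟩
    · simp
    rw [numTilings_eq_sum_nbrs hR ht] at h
    obtain ⟨s, hs, hne⟩ := Finset.exists_ne_zero_of_sum_ne_zero h
    rw [Finset.mem_filter] at hs
    have hlt : (R \ {t, s}).ncard < n := hn ▸ Set.ncard_lt_ncard
      ⟨Set.sdiff_subset, fun hsub => (hsub ht).2 (by simp)⟩ hR
    have key := ih _ hlt (hR.subset Set.sdiff_subset) hne rfl
    -- Exactly one of the two triangles of a lozenge has orientation `b`, so deleting the lozenge
    -- lowers both counts by one.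
    have split : ∀ b : Bool, {u ∈ R | u.up = b}.ncard =
        {u ∈ R \ {t, s} | u.up = b}.ncard + 1 := by
      intro b
      obtain ⟨v, hv, hvb, hv'⟩ : ∃ v ∈ R, v.up = b ∧
          ∀ u, u.up = b → (u = v ↔ u = t ∨ u = s) := by
        have hup := up_of_mem_nbrs hs.1
        by_cases hb : t.up = b
        · refine ⟨t, ht, hb, fun u hu => ⟨Or.inl, fun h => h.resolve_right ?_⟩⟩
          rintro rfl
          rw [hu, hb] at hup
          simp at hup
        · have hb' : s.up = b := by
            rw [hup]; revert hb; cases t.up <;> cases b <;> simp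
          refine ⟨s, hs.2, hb', fun u hu => ⟨Or.inr, fun h => h.resolve_left ?_⟩⟩
          rintro rfl
          exact hb hu
      rw [← Set.ncard_insert_of_notMem (a := v) _ (hR.subset fun u hu => hu.1.1)]
      · congr 1
        ext u
        simp only [Set.mem_ofPred_eq, Set.mem_insert_iff, Set.mem_sdiff, Set.mem_singleton_iff]
        constructor
        · rintro ⟨hu, hub⟩
          have := hv' u hub
          tauto
        · rintro (rfl | hu)
          · exact ⟨hv, hvb⟩
          · exact ⟨hu.1.1, hu.2⟩
      · rintro ⟨⟨_, h2⟩, h3⟩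
        exact h2 ((hv' v h3).1 rfl)
    rw [split, split, key]

/-! ### Dented trapezoids as binomial determinants -/

/-- The trapezoid consisting of `n` rows of unit triangles, with base the segment from `(0, b)`
to `(M, b)`. -/
def trapezoid (b : ℤ) (n : ℕ) (M : ℤ) : Set UnitTriangle :=
  {t | 0 ≤ t.i ∧ b ≤ t.j ∧ t.j < b + n ∧ t.i + (t.j - b) < if t.up then M else M - 1}

/-- The up-pointing unit triangles resting on the line `v = b` at the positions in `D`. -/
def baseUps (b : ℤ) (D : Set ℤ) : Set UnitTriangle :=
  {t | t.up = true ∧ t.j = b ∧ t.i ∈ D}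

/-- The part of a dented trapezoid that is left when the lozenges along the first `p` positions of
the bottom row have been chosen. The dents in the bottom row that are not yet dealt with are `e k`
with `r ≤ k`; those in the second row are `e k` with `k < r`. -/
def partialTrapezoid (b : ℤ) {n : ℕ} (M p : ℕ) (e : Fin (n + 1) → ℕ) (r : ℕ) :
    Set UnitTriangle :=
  {t | (t.j = b ∧ (p : ℤ) ≤ t.i ∧
      ((t.up = true ∧ t.i < M ∧ ∀ k : Fin (n + 1), r ≤ k → (e k : ℤ) ≠ t.i) ∨
        (t.up = false ∧ t.i < M - 1))) ∨
    (b < t.j ∧ t ∈ trapezoid b (n + 1) M ∧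
      ¬ (t.up = true ∧ t.j = b + 1 ∧ ∃ k : Fin (n + 1), (k : ℕ) < r ∧ (e k : ℤ) = t.i))}

/-- The matrix whose signed determinant counts the tilings of `partialTrapezoid`. -/
def partialMatrix {n : ℕ} (e : Fin (n + 1) → ℕ) (r : ℕ) :
    Matrix (Fin (n + 1)) (Fin (n + 1)) ℤ :=
  Matrix.of fun i j =>
    if (i : ℕ) < r then ((e i + 1).choose j : ℤ) - (e i).choose j else (e i).choose j

theorem trapezoid_finite (b : ℤ) (n : ℕ) (M : ℤ) : (trapezoid b n M).Finite := by
  have : (Set.range fun x : (Finset.Icc (0 : ℤ) M) × (Finset.Icc b (b + n)) × Bool =>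
      (⟨x.1, x.2.1, x.2.2⟩ : UnitTriangle)).Finite := Set.finite_range _
  refine this.subset ?_
  rintro ⟨i, j, u⟩ ⟨h1, h2, h3, h4⟩
  simp only at h1 h2 h3 h4
  refine ⟨⟨⟨i, ?_⟩, ⟨j, ?_⟩, u⟩, rfl⟩
  · rw [Finset.mem_Icc]; split_ifs at h4 <;> omega
  · rw [Finset.mem_Icc]; omega

theorem partialTrapezoid_subset (b : ℤ) {n : ℕ} (M p : ℕ) (e : Fin (n + 1) → ℕ) (r : ℕ) :
    partialTrapezoid b M p e r ⊆ trapezoid b (n + 1) M := by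
  rintro ⟨i, j, u⟩ (⟨rfl, h2, h3⟩ | h)
  · simp only at h2 h3
    cases u
    · simp at h3
      simp [trapezoid]
      omega
    · simp at h3
      simp [trapezoid]
      omega
  · exact h.2.1

theorem partialTrapezoid_finite (b : ℤ) {n : ℕ} (M p : ℕ) (e : Fin (n + 1) → ℕ) (r : ℕ) :
    (partialTrapezoid b M p e r).Finite :=
  (trapezoid_finite _ _ _).subset (partialTrapezoid_subset b M p e r)

/-- Once every row is a difference, column `0` consists of differences of `choose _ 0 = 1` and
vanishes. -/
theorem det_partialMatrix_eq_zero {n : ℕ} (e : Fin (n + 1) → ℕ) {r : ℕ} (hr : n + 1 ≤ r) :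
    (partialMatrix e r).det = 0 := by
  refine Matrix.det_eq_zero_of_column_eq_zero 0 fun i => ?_
  have : (i : ℕ) < r := i.2.trans_le hr
  simp [partialMatrix, this]

/-- Only the last row is nonzero in column `0`. After expanding there, Pascal's rule turns each
difference of column `j + 1` into `(e i).choose j`: the matrix for one row fewer. -/
theorem det_partialMatrix_last {n : ℕ} (e : Fin (n + 1) → ℕ) :
    (partialMatrix e n).det =
      (-1) ^ n * (Matrix.of fun i j : Fin n => ((e i.castSucc).choose j : ℤ)).det := by
  rw [Matrix.det_succ_column_zero, Fin.sum_univ_castSucc, Finset.sum_eq_zero]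
  · simp only [Fin.val_last, zero_add, Fin.succAbove_last]
    have h : partialMatrix e n (Fin.last n) 0 = 1 := by simp [partialMatrix]
    rw [h, mul_one]
    congr 2
    ext i j
    simp [partialMatrix, Nat.choose_succ_succ]
  · intro i _
    have : partialMatrix e n i.castSucc 0 = 0 := by simp [partialMatrix]
    simp [this]

/-- Linearity of the determinant in row `r`. The two terms mirror the two lozenges that can cover
the down-pointing triangle next to a dent: the dent moves one step right, or it passes to the second
row. -/
theorem det_partialMatrix_step {n : ℕ} (e : Fin (n + 1) → ℕ) (r : Fin (n + 1)) :
    (partialMatrix e r).det = (partialMatrix (Function.update e r (e r + 1)) r).det -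
      (partialMatrix e (r + 1)).det := by
  have h1 : partialMatrix (Function.update e r (e r + 1)) r =
      (partialMatrix e r).updateRow r (fun j => ((e r + 1).choose j : ℤ)) := by
    ext i j
    rcases eq_or_ne i r with rfl | h
    · simp [partialMatrix]
    · simp [partialMatrix, h]
  have h2 : partialMatrix e (r + 1) = (partialMatrix e r).updateRow r
      (fun j => ((e r + 1).choose j : ℤ) - (e r).choose j) := by
    ext i j
    rcases eq_or_ne i r with rfl | h
    · simp [partialMatrix]
    · have h' : (i : ℕ) ≠ r := fun h' => h (Fin.ext h')
      have : i ≤ r ↔ i < r := ⟨fun hle => lt_of_le_of_ne hle h, le_of_lt⟩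
      simp [partialMatrix, h, this]
  have h3 : partialMatrix e r = (partialMatrix e r).updateRow r
      (fun j => ((e r).choose j : ℤ)) := by
    ext i j
    rcases eq_or_ne i r with rfl | h
    · simp [partialMatrix]
    · simp [h]
  have h4 := Matrix.det_updateRow_add (partialMatrix e r) r (fun j => ((e r).choose j : ℤ))
    (fun j => ((e r + 1).choose j : ℤ) - (e r).choose j)
  rw [← h2, ← h3] at h4
  rw [h1]
  rw [eq_sub_iff_add_eq, ← h4]
  congr 2
  ext j
  simp

/-- A dent cannot move onto an occupied position; algebraically, two rows become equal. -/
theorem det_partialMatrix_update_eq_zero {n : ℕ} (e : Fin (n + 1) → ℕ) (r s : Fin (n + 1))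
    (hrs : r < s) (hs : e s = e r + 1) :
    (partialMatrix (Function.update e r (e r + 1)) r).det = 0 := by
  refine Matrix.det_zero_of_row_eq hrs.ne ?_
  ext j
  have : ¬ s < r := hrs.le.not_gt
  simp [partialMatrix, hrs.ne', hs, this]

section step
variable {b : ℤ} {n M p r : ℕ} {e : Fin (n + 1) → ℕ}

/-- At a position without a dent the leftmost remaining up-pointing triangle has only its right
neighbour left: the left one is used up and the lower one lies outside. -/
theorem numTilings_partialTrapezoid_free (hp : p + 1 < M) (hlt : ∀ k : Fin (n + 1), r ≤ k → p < e k) :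
    numTilings (partialTrapezoid b M p e r) = numTilings (partialTrapezoid b M (p + 1) e r) := by
  have ht : (⟨p, b, true⟩ : UnitTriangle) ∈ partialTrapezoid b M p e r := by
    left
    refine ⟨rfl, le_rfl, Or.inl ⟨rfl, by simp; omega, fun k hk => ?_⟩⟩
    have := hlt k hk
    simp; omega
  have hs : (⟨p, b, false⟩ : UnitTriangle) ∈ partialTrapezoid b M p e r := by
    left
    exact ⟨rfl, le_rfl, Or.inr ⟨rfl, by simp; omega⟩⟩
  rw [numTilings_forced (partialTrapezoid_finite _ _ _ _ _) ht hs (by simp)]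
  · congr 1
    ext ⟨i, j, u⟩
    cases u
    · simp [partialTrapezoid, trapezoid]
      omega
    · simp [partialTrapezoid]
      constructor
      · rintro ⟨h | h, h'⟩
        · left; refine ⟨h.1, ?_, h.2.2⟩; omega
        · exact Or.inr h
      · rintro (h | h)
        · refine ⟨Or.inl ⟨h.1, by omega, h.2.2⟩, by omega⟩
        · exact ⟨Or.inr h, by omega⟩
  · intro u hu hR
    simp at hu
    rcases hu with rfl | rfl | rfl
    · rfl
    · simp [partialTrapezoid] at hR
    · simp [partialTrapezoid] at hR
      omega

/-- With a dent at `p`, covering the down-pointing triangle at `p` sideways uses the up-pointing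
triangle at `p + 1`, which leaves the region with the dent moved there. -/
theorem diff_pair_row_eq (hr : r < n + 1) (her : e ⟨r, hr⟩ = p) :
    partialTrapezoid b M p e r \ {⟨p, b, false⟩, ⟨p + 1, b, true⟩} =
      partialTrapezoid b M (p + 1) (Function.update e ⟨r, hr⟩ (p + 1)) r := by
  have key1 : ∀ i : ℤ, ((p : ℤ) ≤ i ∧ (∀ k : Fin (n + 1), r ≤ k → (e k : ℤ) ≠ i) ∧ i ≠ p + 1) ↔
      ((p : ℤ) + 1 ≤ i ∧ ∀ k : Fin (n + 1), r ≤ k →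
        ((Function.update e ⟨r, hr⟩ (p + 1) k : ℕ) : ℤ) ≠ i) := by
    intro i
    constructor
    · rintro ⟨h1, h2, h3⟩
      have := h2 ⟨r, hr⟩ le_rfl
      rw [her] at this
      refine ⟨by omega, fun k hk => ?_⟩
      rcases eq_or_ne k ⟨r, hr⟩ with rfl | hne
      · simp; omega
      · rw [Function.update_of_ne hne]; exact h2 k hk
    · rintro ⟨h1, h2⟩
      have h3 := h2 ⟨r, hr⟩ le_rfl
      simp at h3
      refine ⟨by omega, fun k hk => ?_, by omega⟩
      rcases eq_or_ne k ⟨r, hr⟩ with rfl | hne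
      · rw [her]; omega
      · have := h2 k hk
        rwa [Function.update_of_ne hne] at this
  have key2 : ∀ i : ℤ, (∃ k : Fin (n + 1), (k : ℕ) < r ∧
      ((Function.update e ⟨r, hr⟩ (p + 1) k : ℕ) : ℤ) = i) ↔
      ∃ k : Fin (n + 1), (k : ℕ) < r ∧ (e k : ℤ) = i := by
    intro i
    refine exists_congr fun k => and_congr_right fun hk => ?_
    rw [Function.update_of_ne]
    rintro rfl
    simp at hk
  ext ⟨i, j, u⟩
  cases u
  · simp [partialTrapezoid, trapezoid]
    omega
  · have k1 := key1 i
    have k2 := key2 i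
    simp only [partialTrapezoid, Set.mem_sdiff, Set.mem_ofPred_eq, k2, Set.mem_insert_iff,
      Set.mem_singleton_iff, UnitTriangle.mk.injEq, Nat.cast_add, Nat.cast_one]
    simp only [Bool.true_eq_false, and_false, false_or, and_true, true_and, false_and, or_false]
    constructor
    · rintro ⟨h | h, h'⟩
      · have := k1.1 ⟨h.2.1, h.2.2.2, fun hh => h' ⟨hh, h.1⟩⟩
        exact Or.inl ⟨h.1, this.1, h.2.2.1, this.2⟩
      · exact Or.inr h
    · rintro (h | h)
      · have := k1.2 ⟨h.2.1, h.2.2.2⟩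
        exact ⟨Or.inl ⟨h.1, this.1, h.2.2.1, this.2.1⟩, fun hh => this.2.2 hh.1⟩
      · exact ⟨Or.inr h, fun hh => by have := h.1; omega⟩

/-- Covering the down-pointing triangle at `p` by a vertical lozenge removes the up-pointing
triangle above it, so the dent reappears at the same position of the second row. -/
theorem diff_pair_vertical_eq (hr : r < n + 1) (her : e ⟨r, hr⟩ = p) :
    partialTrapezoid b M p e r \ {⟨p, b, false⟩, ⟨p, b + 1, true⟩} =
      partialTrapezoid b M (p + 1) e (r + 1) := by
  have key1 : ∀ i : ℤ, ((p : ℤ) ≤ i ∧ ∀ k : Fin (n + 1), r ≤ k → (e k : ℤ) ≠ i) ↔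
      ((p : ℤ) + 1 ≤ i ∧ ∀ k : Fin (n + 1), r + 1 ≤ k → (e k : ℤ) ≠ i) := by
    intro i
    constructor
    · rintro ⟨h1, h2⟩
      have := h2 ⟨r, hr⟩ le_rfl
      rw [her] at this
      exact ⟨by omega, fun k hk => h2 k (by omega)⟩
    · rintro ⟨h1, h2⟩
      refine ⟨by omega, fun k hk => ?_⟩
      rcases eq_or_ne k ⟨r, hr⟩ with rfl | hne
      · rw [her]; omega
      · refine h2 k ?_
        have : (k : ℕ) ≠ r := fun h => hne (Fin.ext h)
        omega
  have key2 : ∀ i : ℤ, (∃ k : Fin (n + 1), (k : ℕ) < r + 1 ∧ (e k : ℤ) = i) ↔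
      (∃ k : Fin (n + 1), (k : ℕ) < r ∧ (e k : ℤ) = i) ∨ i = p := by
    intro i
    constructor
    · rintro ⟨k, hk, rfl⟩
      rcases eq_or_ne k ⟨r, hr⟩ with rfl | hne
      · right; rw [her]
      · have : (k : ℕ) ≠ r := fun h => hne (Fin.ext h)
        exact Or.inl ⟨k, by omega, rfl⟩
    · rintro (⟨k, hk, h⟩ | rfl)
      · exact ⟨k, by omega, h⟩
      · exact ⟨⟨r, hr⟩, by simp, by rw [her]⟩
  ext ⟨i, j, u⟩
  cases u
  · simp [partialTrapezoid, trapezoid]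
    omega
  · have k1 := key1 i
    have k2 := key2 i
    simp only [partialTrapezoid, Set.mem_sdiff, Set.mem_ofPred_eq, k2, Set.mem_insert_iff,
      Set.mem_singleton_iff, UnitTriangle.mk.injEq, Nat.cast_add, Nat.cast_one]
    simp only [Bool.true_eq_false, and_false, false_or, and_true, true_and, false_and, or_false]
    constructor
    · rintro ⟨h | h, h'⟩
      · have := k1.1 ⟨h.2.1, h.2.2.2⟩
        exact Or.inl ⟨h.1, this.1, h.2.2.1, this.2⟩
      · refine Or.inr ⟨h.1, h.2.1, fun hh => ?_⟩
        rcases hh.2 with h3 | h3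
        · exact h.2.2 ⟨hh.1, h3⟩
        · exact h' ⟨h3, hh.1⟩
    · rintro (h | h)
      · have := k1.2 ⟨h.2.1, h.2.2.2⟩
        exact ⟨Or.inl ⟨h.1, this.1, h.2.2.1, this.2⟩, fun hh => by have := h.1; omega⟩
      · refine ⟨Or.inr ⟨h.1, h.2.1, fun hh => h.2.2 ⟨hh.1, Or.inl hh.2⟩⟩, fun hh => ?_⟩
        exact h.2.2 ⟨hh.2, Or.inr hh.1⟩

end step

theorem strictMono_update_succ {n : ℕ} {e : Fin (n + 1) → ℕ} (he : StrictMono e)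
    (r : Fin (n + 1)) (h : ∀ k, r < k → e r + 1 < e k) :
    StrictMono (Function.update e r (e r + 1)) := by
  intro i j hij
  rcases eq_or_ne i r with rfl | hi
  · rw [Function.update_self, Function.update_of_ne hij.ne']
    exact h j hij
  · rw [Function.update_of_ne hi]
    rcases eq_or_ne j r with rfl | hj
    · rw [Function.update_self]
      exact (he hij).trans (Nat.lt_succ_self _)
    · rw [Function.update_of_ne hj]
      exact he hij

/-- The number of tilings of the trapezoid with the given dents is a determinant of binomial
coefficients. -/
def DentFormula (n : ℕ) : Prop :=
  ∀ (b : ℤ) (M : ℕ) (e : Fin n → ℕ), StrictMono e → (∀ k, e k < M) →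
    (numTilings (trapezoid b n M \ baseUps b (Set.range fun k => (e k : ℤ))) : ℤ) =
      (Matrix.of fun i j : Fin n => ((e i).choose j : ℤ)).det

/-- At the last position of the bottom row there are two cases. If all dents have passed to the
second row, the last up-pointing triangle is isolated and both sides vanish. Otherwise exactly the
last dent sits there, the bottom row is finished, and a trapezoid with `n` rows and `n` dents
remains. -/
theorem numTilings_partialTrapezoid_end {n : ℕ} (ih : DentFormula n) (b : ℤ) (p r : ℕ)
    (e : Fin (n + 1) → ℕ) (he : StrictMono e) (hr : r ≤ n + 1)
    (hlt : ∀ k : Fin (n + 1), (k : ℕ) < r → e k < p)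
    (hge : ∀ k : Fin (n + 1), r ≤ k → p ≤ e k) (hM : ∀ k, e k < p + 1) :
    (numTilings (partialTrapezoid b (p + 1) p e r) : ℤ) = (-1) ^ r * (partialMatrix e r).det := by
  rcases hr.eq_or_lt with rfl | hr'
  · rw [det_partialMatrix_eq_zero e le_rfl, mul_zero, Nat.cast_eq_zero]
    refine numTilings_eq_zero (partialTrapezoid_finite _ _ _ _ _) (t := ⟨p, b, true⟩) ?_ ?_
    · left
      exact ⟨rfl, le_rfl, Or.inl ⟨rfl, by simp, fun k hk => absurd k.2 (by omega)⟩⟩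
    · intro s hs hR
      simp at hs
      rcases hs with rfl | rfl | rfl <;> simp [partialTrapezoid] at hR
      omega
  · have h1 : r = n := by
      by_contra hne
      have a1 := he (show (⟨r, hr'⟩ : Fin (n + 1)) < Fin.last n from by
        rw [Fin.lt_def]; simp; omega)
      have a2 := hge ⟨r, hr'⟩ le_rfl
      have a3 := hM (Fin.last n)
      omega
    subst h1
    rw [det_partialMatrix_last, ← mul_assoc, ← mul_pow]
    have := ih (b + 1) p (fun k => e k.castSucc) (fun i j h => he (by simpa using h))
      (fun k => hlt _ (by simp))
    simp only [mul_neg, mul_one, neg_neg, one_pow, one_mul]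
    rw [← this]
    congr 2
    have hlast : e (Fin.last r) = p := le_antisymm (Nat.lt_succ_iff.1 (hM _)) (hge _ le_rfl)
    have hex : ∀ i : ℤ, (∃ k : Fin (r + 1), (k : ℕ) < r ∧ (e k : ℤ) = i) ↔
        ∃ k : Fin r, (e k.castSucc : ℤ) = i := by
      intro i
      constructor
      · rintro ⟨k, hk, h⟩
        exact ⟨⟨k, hk⟩, h⟩
      · rintro ⟨k, h⟩
        exact ⟨k.castSucc, by simp, h⟩
    ext ⟨i, j, u⟩
    cases u
    · simp [partialTrapezoid, baseUps, trapezoid]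
      omega
    · simp only [partialTrapezoid, Set.mem_ofPred_eq, hex, Set.mem_sdiff, baseUps, Set.mem_range]
      simp only [trapezoid, Set.mem_ofPred_eq, if_true, true_and, Bool.true_eq_false, false_and,
        or_false, Nat.cast_add, Nat.cast_one]
      constructor
      · rintro (h | h)
        · exfalso
          refine h.2.2.2 (Fin.last r) (by simp) ?_
          rw [hlast]
          omega
        · exact ⟨by omega, h.2.2⟩
      · rintro ⟨h1, h2⟩
        exact Or.inr ⟨by omega, by omega, h2⟩

/-- The bottom row is tiled from left to right, with `d` the number of positions after `p`. The sign
`(-1) ^ r` absorbs the minus sign in `det_partialMatrix_step` each time a dent passes upwards. -/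
theorem numTilings_partialTrapezoid {n : ℕ} (ih : DentFormula n) (b : ℤ) (d : ℕ) :
    ∀ (M p r : ℕ) (e : Fin (n + 1) → ℕ), M = p + 1 + d → StrictMono e → r ≤ n + 1 →
    (∀ k : Fin (n + 1), (k : ℕ) < r → e k < p) →
    (∀ k : Fin (n + 1), r ≤ k → p ≤ e k) → (∀ k, e k < M) →
    (numTilings (partialTrapezoid b M p e r) : ℤ) = (-1) ^ r * (partialMatrix e r).det := by
  induction d with
  | zero =>
    rintro M p r e rfl he hr hlt hge hM
    exact numTilings_partialTrapezoid_end ih b p r e he hr hlt hge hM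
  | succ d ihd =>
    intro M p r e hMp he hr hlt hge hM
    by_cases hfree : ∀ k : Fin (n + 1), r ≤ k → p < e k
    · rw [numTilings_partialTrapezoid_free (by omega) hfree]
      exact ihd M (p + 1) r e (by omega) he hr (fun k hk => (hlt k hk).trans (Nat.lt_succ_self _))
        hfree hM
    · push Not at hfree
      obtain ⟨k, hk, hkp⟩ := hfree
      have hr' : r < n + 1 := hk.trans_lt k.2
      have hmono : ∀ l : Fin (n + 1), r ≤ l → e ⟨r, hr'⟩ ≤ e l := fun l hl => he.monotone hl
      have her : e ⟨r, hr'⟩ = p := le_antisymm ((hmono k hk).trans hkp) (hge _ le_rfl)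
      have hgt : ∀ l : Fin (n + 1), r < l → p + 1 ≤ e l := fun l hl => by
        have := he (show (⟨r, hr'⟩ : Fin (n + 1)) < l from hl)
        omega
      have hfin := partialTrapezoid_finite b M p e r
      have hdown : (⟨p, b, false⟩ : UnitTriangle) ∈ partialTrapezoid b M p e r :=
        Or.inl ⟨rfl, le_rfl, Or.inr ⟨rfl, by simp; omega⟩⟩
      have hnot : (⟨p, b, true⟩ : UnitTriangle) ∉ partialTrapezoid b M p e r := by
        simp [partialTrapezoid]
        exact fun _ => ⟨⟨r, hr'⟩, le_rfl, her⟩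
      -- A second row exists only for `0 < n`; there the position `p` is still free because all
      -- earlier dents lie to the left of it.
      have hvert : (⟨p, b + 1, true⟩ : UnitTriangle) ∈ partialTrapezoid b M p e r ↔ 0 < n := by
        simp [partialTrapezoid, trapezoid]
        constructor
        · intro h; omega
        · intro h
          refine ⟨⟨by omega, by omega⟩, fun k hk => ?_⟩
          have := hlt k hk
          omega
      have hstep := det_partialMatrix_step e ⟨r, hr'⟩
      simp only [her] at hstep
      have hB := ihd M (p + 1) (r + 1) e (by omega) he hr'
        (fun l hl => by
          rcases Nat.lt_succ_iff_lt_or_eq.1 hl with h | h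
          · have := hlt l h; omega
          · have : l = ⟨r, hr'⟩ := Fin.ext h
            rw [this, her]; omega)
        (fun l hl => hgt l hl) hM
      -- The dent can move right exactly when the next dent is not adjacent to it.
      by_cases hA : ∀ l : Fin (n + 1), r < l → p + 1 < e l
      · have hside : (⟨p + 1, b, true⟩ : UnitTriangle) ∈ partialTrapezoid b M p e r := by
          refine Or.inl ⟨rfl, by simp, Or.inl ⟨rfl, by simp; omega, fun l hl => ?_⟩⟩
          rcases hl.eq_or_lt with h | h
          · have : l = ⟨r, hr'⟩ := Fin.ext h.symm
            rw [this, her]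
            simp
          · have := hA l h
            simp; omega
        have hAn := ihd M (p + 1) r (Function.update e ⟨r, hr'⟩ (p + 1)) (by omega)
          (by have := strictMono_update_succ he ⟨r, hr'⟩ (by rw [her]; exact fun l hl => hA l hl)
              rwa [her] at this) hr
          (fun l hl => by
            have := hlt l hl
            rw [Function.update_of_ne]
            · omega
            · rintro rfl; simp at hl)
          (fun l hl => by
            rcases eq_or_ne l ⟨r, hr'⟩ with rfl | hne
            · simp
            · rw [Function.update_of_ne hne]
              refine hgt l ?_
              have : (l : ℕ) ≠ r := fun h => hne (Fin.ext h)
              omega)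
          (fun l => by
            rcases eq_or_ne l ⟨r, hr'⟩ with rfl | hne
            · simp; omega
            · rw [Function.update_of_ne hne]; exact hM l)
        -- In a one-row trapezoid the dent must move right; otherwise both coverings occur.
        rcases Nat.eq_zero_or_pos n with hn | hn
        · have hv : (⟨p, b + 1, true⟩ : UnitTriangle) ∉ partialTrapezoid b M p e r := by
            rw [hvert]; omega
          rw [numTilings_forced hfin hdown hside (by simp), diff_pair_row_eq hr' her, hAn, hstep,
            det_partialMatrix_eq_zero e (r := r + 1) (by omega), sub_zero]
          intro u hu hR
          simp at hu
          rcases hu with rfl | rfl | rfl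
          · exact absurd hR hnot
          · rfl
          · exact absurd hR hv
        · rw [numTilings_branch hfin hdown hside (hvert.2 hn) (by simp) (by simp) (by simp),
            diff_pair_row_eq hr' her, diff_pair_vertical_eq hr' her, Nat.cast_add, hAn, hB,
            hstep]
          · ring
          intro u hu hR
          simp at hu
          rcases hu with rfl | rfl | rfl
          · exact absurd hR hnot
          · exact Or.inl rfl
          · exact Or.inr rfl
      · push Not at hA
        obtain ⟨l, hl, hle⟩ := hA
        have hel : e l = p + 1 := le_antisymm hle (hgt l hl)
        have hz := det_partialMatrix_update_eq_zero e ⟨r, hr'⟩ l hl (by rw [hel, her])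
        simp only [her] at hz
        have hn : 0 < n := by have := l.2; omega
        have hside : (⟨p + 1, b, true⟩ : UnitTriangle) ∉ partialTrapezoid b M p e r := by
          simp [partialTrapezoid]
          intro _
          exact ⟨l, hl.le, by omega⟩
        rw [numTilings_forced hfin hdown (hvert.2 hn) (by simp), diff_pair_vertical_eq hr' her,
          hB, hstep, hz]
        · ring
        intro u hu hR
        simp at hu
        rcases hu with rfl | rfl | rfl
        · exact absurd hR hnot
        · exact absurd hR hside
        · rfl

theorem dentFormula (n : ℕ) : DentFormula n := by
  induction n with
  | zero =>
    intro b M e _ _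
    have : trapezoid b 0 M \ baseUps b (Set.range fun k => (e k : ℤ)) = ∅ := by
      ext ⟨i, j, u⟩
      simp [trapezoid]
      omega
    rw [this, numTilings_empty]
    simp
  | succ n ih =>
    intro b M e he hM
    have hM0 := hM 0
    have := numTilings_partialTrapezoid ih b (M - 1) M 0 0 e (by omega) he (by omega) (by simp)
      (by simp) hM
    have h2 : partialMatrix e 0 = Matrix.of fun i j : Fin (n + 1) => ((e i).choose j : ℤ) := by
      ext i j
      simp [partialMatrix]
    rw [pow_zero, one_mul, h2] at this
    rw [← this]
    congr 2
    ext ⟨i, j, u⟩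
    cases u
    · simp [partialTrapezoid, baseUps, trapezoid]
      omega
    · simp [partialTrapezoid, baseUps, trapezoid]
      constructor
      · rintro ⟨h1, h2⟩
        rcases h1.2.1.eq_or_lt with h | h
        · exact Or.inl ⟨h.symm, h1.1, by omega, h2 h.symm⟩
        · exact Or.inr ⟨h, by omega⟩
      · rintro (h | h)
        · exact ⟨by omega, fun _ => h.2.2.2⟩
        · exact ⟨by omega, by omega⟩

/-! ### The product formula for dented trapezoids -/

/-- The product of the differences of the elements of a finite set of integers. -/
def vand (D : Finset ℤ) : ℕ :=
  ∏ s ∈ D, ∏ t ∈ D with s < t, (t - s).natAbs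

/-- Scaling column `j` by `j!` turns binomials into descending factorials, monic polynomials of
degree `j` in `e i`, so the determinant becomes that of Vandermonde. The scaling factors multiply to
`hyperfact n`. -/
theorem det_choose_mul_hyperfact {n : ℕ} (e : Fin n → ℕ) :
    (Matrix.of fun i j : Fin n => ((e i).choose j : ℤ)).det * hyperfact n =
      ∏ i : Fin n, ∏ j ∈ Finset.Ioi i, ((e j : ℤ) - e i) := by
  have h := Matrix.det_eval_matrixOfPolynomials_eq_det_vandermonde (fun i => (e i : ℤ))
    (fun i => descPochhammer ℤ i) (fun i => descPochhammer_natDegree ℤ i)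
    (fun i => monic_descPochhammer ℤ i)
  rw [← Matrix.det_vandermonde, h, hyperfact, mul_comm, ← Fin.prod_univ_eq_prod_range,
    Nat.cast_prod, ← Matrix.det_mul_row]
  congr 1
  ext i j
  rw [Matrix.of_apply, Matrix.of_apply, Matrix.of_apply, descPochhammer_eval_eq_descFactorial,
    Nat.descFactorial_eq_factorial_mul_choose]
  push_cast
  rfl

theorem vand_eq_prod_fin (D : Finset ℤ) {n : ℕ} (h : D.card = n) :
    (vand D : ℤ) = ∏ i : Fin n, ∏ j ∈ Finset.Ioi i, (D.orderEmbOfFin h j - D.orderEmbOfFin h i) := by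
  have h1 : ∀ f : ℤ → ℤ, ∏ s ∈ D, f s = ∏ i : Fin n, f (D.orderEmbOfFin h i) := by
    intro f
    conv_lhs => rw [← Finset.map_orderEmbOfFin_univ D h]
    rw [Finset.prod_map]
    rfl
  rw [vand, Nat.cast_prod, h1]
  refine Finset.prod_congr rfl fun i _ => ?_
  have h2 : ({t ∈ D | D.orderEmbOfFin h i < t} : Finset ℤ) =
      (Finset.Ioi i).map (D.orderEmbOfFin h).toEmbedding := by
    ext t
    simp only [Finset.mem_filter, Finset.mem_map, Finset.mem_Ioi]
    constructor
    · rintro ⟨ht, hlt⟩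
      obtain ⟨j, rfl⟩ : t ∈ Set.range (D.orderEmbOfFin h) := by
        rw [Finset.range_orderEmbOfFin]; exact ht
      exact ⟨j, by simpa using hlt, rfl⟩
    · rintro ⟨j, hj, rfl⟩
      exact ⟨D.orderEmbOfFin_mem h j, by simpa using hj⟩
  rw [h2, Finset.prod_map, Nat.cast_prod]
  refine Finset.prod_congr rfl fun j hj => ?_
  rw [Finset.mem_Ioi] at hj
  have : D.orderEmbOfFin h i < D.orderEmbOfFin h j := by simpa using hj
  simp only [RelEmbedding.coe_toEmbedding]
  omega

/-- The Cohn–Larsen–Propp formula for the number of tilings of a dented trapezoid. -/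
theorem numTilings_trapezoid_mul_hyperfact (b : ℤ) {n M : ℕ} {D : Finset ℤ}
    (hD : D ⊆ Finset.Ico 0 (M : ℤ)) (hcard : D.card = n) :
    numTilings (trapezoid b n M \ baseUps b D) * hyperfact n = vand D := by
  have hmem : ∀ k, 0 ≤ D.orderEmbOfFin hcard k ∧ D.orderEmbOfFin hcard k < M := fun k => by
    simpa using hD (D.orderEmbOfFin_mem hcard k)
  have hcast : ∀ k, (((D.orderEmbOfFin hcard k).toNat : ℕ) : ℤ) = D.orderEmbOfFin hcard k :=
    fun k => Int.toNat_of_nonneg (hmem k).1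
  have h := dentFormula n b M (fun k => (D.orderEmbOfFin hcard k).toNat)
    (fun i j hij => by
      have h1 : D.orderEmbOfFin hcard i < D.orderEmbOfFin hcard j := by simpa using hij
      have := hcast i
      have := hcast j
      show Int.toNat _ < Int.toNat _
      omega)
    (fun k => by have := hcast k; have := hmem k; show Int.toNat _ < _; omega)
  simp only [hcast] at h
  rw [Finset.range_orderEmbOfFin] at h
  zify
  rw [h, det_choose_mul_hyperfact, vand_eq_prod_fin D hcard]
  simp only [hcast]

/-- Each row of the full trapezoid has one more up-pointing than down-pointing triangle, so a tiling
requires exactly `n` dents. For `n = 0` the region is empty and has one tiling whatever `D` is,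
hence `0 < n`. -/
theorem numTilings_trapezoid_eq_zero (b : ℤ) {n M : ℕ} (hn : n ≤ M) {D : Finset ℤ}
    (hD : D ⊆ Finset.Ico 0 (M : ℤ)) (hpos : 0 < n) (hcard : D.card ≠ n) :
    numTilings (trapezoid b n M \ baseUps b D) = 0 := by
  by_contra hne
  apply hcard
  have hfin : (trapezoid b n M \ baseUps b D).Finite := (trapezoid_finite _ _ _).subset Set.sdiff_subset
  have key := ncard_up_eq_ncard_down hfin hne
  set A : Set UnitTriangle := {t ∈ trapezoid b n M \ baseUps b D | t.up = true}
  set B : Set UnitTriangle := {t ∈ trapezoid b n M \ baseUps b D | t.up = false}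
  have hA : A.Finite := hfin.subset fun t ht => ht.1
  have hB : B.Finite := hfin.subset fun t ht => ht.1
  set E : Set UnitTriangle := (fun d : ℤ => (⟨d, b, true⟩ : UnitTriangle)) '' D
  set F : Set UnitTriangle := (fun d : ℤ => (⟨0, d, true⟩ : UnitTriangle)) '' (Finset.Ico b (b + n))
  set B' : Set UnitTriangle := (fun t : UnitTriangle => (⟨t.i + 1, t.j, true⟩ : UnitTriangle)) '' B
  have hE : E.ncard = D.card := by
    rw [Set.ncard_image_of_injective _ (fun x y h => by simpa using h), Set.ncard_coe_finset]
  have hF : F.ncard = n := by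
    rw [Set.ncard_image_of_injective _ (fun x y h => by simpa using h), Set.ncard_coe_finset]
    simp
  have hB' : B'.ncard = B.ncard := by
    refine Set.InjOn.ncard_image fun s hs t ht h => ?_
    obtain ⟨i, j, u⟩ := s
    obtain ⟨i', j', u'⟩ := t
    have h1 : u = false := hs.2
    have h2 : u' = false := ht.2
    simp at h
    simp [h, h1, h2]
  -- Shifting the down-pointing triangles one step right, within their rows, hits every up-pointing
  -- triangle of the full trapezoid except the leftmost of each row, collected in `F`.
  have hunion : A ∪ E = B' ∪ F := by
    ext ⟨i, j, u⟩
    have hB'mem : (⟨i, j, u⟩ : UnitTriangle) ∈ B' ↔ u = true ∧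
        (⟨i - 1, j, false⟩ : UnitTriangle) ∈ trapezoid b n M := by
      constructor
      · rintro ⟨⟨k, l, w⟩, ⟨h1, h2⟩, h3⟩
        simp at h2 h3
        obtain ⟨rfl, rfl, rfl⟩ := h3
        subst h2
        exact ⟨rfl, by simpa using h1.1⟩
      · rintro ⟨rfl, h⟩
        exact ⟨⟨i - 1, j, false⟩, ⟨⟨h, by simp [baseUps]⟩, rfl⟩, by simp⟩
    have hDi := @hD i
    rw [Finset.mem_Ico] at hDi
    rw [Set.mem_union, Set.mem_union, hB'mem]
    cases u
    · simp [A, E, F]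
    · simp [A, E, F, trapezoid, baseUps]
      by_cases h : i ∈ D
      · have := hDi h
        simp [h]
        omega
      · simp [h]
        constructor
        · intro h'
          by_cases hi : i = 0
          · right; omega
          · left; omega
        · intro h'
          omega
  have hd1 : Disjoint A E := by
    rw [Set.disjoint_left]
    rintro ⟨i, j, u⟩ h1 ⟨d, hd, h2⟩
    refine h1.1.2 ?_
    rw [← h2]
    exact ⟨rfl, rfl, hd⟩
  have hd2 : Disjoint B' F := by
    rw [Set.disjoint_left]
    rintro _ ⟨t, ht, rfl⟩ ⟨d, hd, h2⟩
    have := ht.1.1.1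
    simp at h2
    omega
  have hcount := congrArg Set.ncard hunion
  rw [Set.ncard_union_eq hd1 hA (D.finite_toSet.image _),
    Set.ncard_union_eq hd2 (hB.image _) ((Finset.finite_toSet _).image _), hE, hF, hB', key] at hcount
  omega

/-! ### Removing large triangles by removing their bases -/

@[simp] theorem mem_trianglesIn_up {P : Set (ℤ × ℤ)} {i j : ℤ} :
    (⟨i, j, true⟩ : UnitTriangle) ∈ trianglesIn P ↔
      (i, j) ∈ P ∧ (i + 1, j) ∈ P ∧ (i, j + 1) ∈ P := by
  rw [trianglesIn, Set.mem_ofPred_eq, UnitTriangle.vertices, if_pos rfl, Finset.forall_mem_insert,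
    Finset.forall_mem_insert]
  simp only [Finset.mem_singleton, forall_eq]

@[simp] theorem mem_trianglesIn_down {P : Set (ℤ × ℤ)} {i j : ℤ} :
    (⟨i, j, false⟩ : UnitTriangle) ∈ trianglesIn P ↔
      (i + 1, j) ∈ P ∧ (i, j + 1) ∈ P ∧ (i + 1, j + 1) ∈ P := by
  rw [trianglesIn, Set.mem_ofPred_eq, UnitTriangle.vertices, if_neg (by simp),
    Finset.forall_mem_insert, Finset.forall_mem_insert]
  simp only [Finset.mem_singleton, forall_eq]

theorem mem_bigTriangle_up {p b i j : ℤ} {n : ℕ} {u : Bool} :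
    (⟨i, j, u⟩ : UnitTriangle) ∈ bigTriangle (p, b) n true ↔
      p ≤ i ∧ b ≤ j ∧ i + j < if u then p + b + n else p + b + n - 1 := by
  cases u <;> simp [bigTriangle] <;> omega

theorem mem_bigTriangle_down {p b i j : ℤ} {n : ℕ} {u : Bool} :
    (⟨i, j, u⟩ : UnitTriangle) ∈ bigTriangle (p, b) n false ↔
      i < p + n ∧ j < b ∧ p + b ≤ i + j + if u then 0 else 1 := by
  cases u <;> simp [bigTriangle] <;> omega

/-- Removing a large triangle has the same effect on the number of tilings as removing the unit
triangles along its base. -/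
theorem numTilings_diff_bigTriangle {R : Set UnitTriangle} (hR : R.Finite) (p b : ℤ) (n : ℕ)
    (h : bigTriangle (p, b) n true ⊆ R) :
    numTilings (R \ bigTriangle (p, b) n true) =
      numTilings (R \ baseUps b (Finset.Ico p (p + n))) := by
  induction n generalizing R b with
  | zero =>
    congr 1
    ext ⟨i, j, u⟩
    have h1 : (⟨i, j, u⟩ : UnitTriangle) ∉ bigTriangle (p, b) 0 true := by
      rw [mem_bigTriangle_up]; cases u <;> simp <;> omega
    simp [h1, baseUps]
  | succ n ih =>
    -- Between two adjacent removed base triangles the down-pointing triangle can only be matched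
    -- upwards. These `n` forced lozenges remove the base of a triangle of size `n` in the next row.
    have row : ∀ m : ℕ, m ≤ n → numTilings (R \ baseUps b (Finset.Ico p (p + (n + 1 : ℕ)))) =
        numTilings ((R \ baseUps b (Finset.Ico p (p + (n + 1 : ℕ)))) \
          {t | p ≤ t.i ∧ t.i < p + m ∧
            ((t.j = b ∧ t.up = false) ∨ (t.j = b + 1 ∧ t.up = true))}) := by
      intro m
      induction m with
      | zero =>
        intro _
        congr 1
        ext t
        simp
        omega
      | succ m ihm =>
        intro hm
        rw [ihm (by omega), numTilings_forced (s := ⟨p + m, b + 1, true⟩) (t := ⟨p + m, b, false⟩)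
          (hR.subset (Set.sdiff_subset.trans Set.sdiff_subset))]
        · congr 1
          ext ⟨i, j, u⟩
          cases u
          · simp [baseUps]
            grind
          · simp [baseUps]
            grind
        · refine ⟨⟨h ?_, by simp [baseUps]⟩, by simp⟩
          rw [mem_bigTriangle_up]
          simp
          omega
        · refine ⟨⟨h ?_, by simp [baseUps]⟩, by simp⟩
          rw [mem_bigTriangle_up]
          simp
          omega
        · simp
        · intro u hu hu'
          simp at hu
          rcases hu with rfl | rfl | rfl
          · refine absurd ⟨rfl, rfl, ?_⟩ hu'.1.2
            simp; omega
          · refine absurd ⟨rfl, rfl, ?_⟩ hu'.1.2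
            simp; omega
          · rfl
    have hrow := row n le_rfl
    -- The induction hypothesis is applied to `R` without the bottom row of the large triangle.
    have hi := ih (R := R \ {t | p ≤ t.i ∧ t.j = b ∧
        t.i < if t.up then p + n + 1 else p + n}) (hR.subset Set.sdiff_subset) (b + 1) (by
      rintro ⟨i, j, u⟩ ht
      refine ⟨h ?_, ?_⟩
      · rw [mem_bigTriangle_up] at ht ⊢
        cases u <;> simp at ht ⊢ <;> omega
      · rw [mem_bigTriangle_up] at ht
        simp; omega)
    have e1 : (R \ {t | p ≤ t.i ∧ t.j = b ∧ t.i < if t.up then p + n + 1 else p + n}) \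
        bigTriangle (p, b + 1) n true = R \ bigTriangle (p, b) (n + 1) true := by
      ext ⟨i, j, u⟩
      simp only [Set.mem_sdiff, mem_bigTriangle_up]
      cases u <;> simp <;> grind
    have e2 : (R \ {t | p ≤ t.i ∧ t.j = b ∧ t.i < if t.up then p + n + 1 else p + n}) \
        baseUps (b + 1) (Finset.Ico p (p + n)) =
        (R \ baseUps b (Finset.Ico p (p + (n + 1 : ℕ)))) \
          {t | p ≤ t.i ∧ t.i < p + n ∧
            ((t.j = b ∧ t.up = false) ∨ (t.j = b + 1 ∧ t.up = true))} := by
      ext ⟨i, j, u⟩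
      cases u <;> simp [baseUps] <;> grind
    rw [e1, e2] at hi
    rw [hi, hrow]

theorem numTilings_diff_bigTriangles (b : ℤ) (l : List (ℤ × ℕ)) {R : Set UnitTriangle}
    (hR : R.Finite) (hsub : ∀ x ∈ l, bigTriangle (x.1, b) x.2 true ⊆ R)
    (hdis : l.Pairwise fun x y =>
      Disjoint (bigTriangle (x.1, b) x.2 true) (bigTriangle (y.1, b) y.2 true)) :
    numTilings (R \ {t | ∃ x ∈ l, t ∈ bigTriangle (x.1, b) x.2 true}) =
      numTilings (R \ baseUps b {i | ∃ x ∈ l, x.1 ≤ i ∧ i < x.1 + x.2}) := by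
  induction l generalizing R with
  | nil => simp [baseUps]
  | cons x l ih =>
    rw [List.pairwise_cons] at hdis
    have e1 : R \ {t | ∃ y ∈ x :: l, t ∈ bigTriangle (y.1, b) y.2 true} =
        (R \ bigTriangle (x.1, b) x.2 true) \ {t | ∃ y ∈ l, t ∈ bigTriangle (y.1, b) y.2 true} := by
      ext t
      simp
      tauto
    have e2 : (R \ bigTriangle (x.1, b) x.2 true) \
          baseUps b {i | ∃ y ∈ l, y.1 ≤ i ∧ i < y.1 + y.2} =
        (R \ baseUps b {i | ∃ y ∈ l, y.1 ≤ i ∧ i < y.1 + y.2}) \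
          bigTriangle (x.1, b) x.2 true := by
      rw [Set.sdiff_sdiff_comm]
    rw [e1, ih (hR.subset Set.sdiff_subset) ?_ hdis.2, e2, numTilings_diff_bigTriangle
      (hR.subset Set.sdiff_subset)]
    · congr 1
      ext t
      simp [baseUps]
      tauto
    · intro t ht
      refine ⟨hsub x (by simp) ht, ?_⟩
      rintro ⟨h1, h2, y, hy, hy1, hy2⟩
      refine Set.disjoint_left.1 (hdis.1 y hy) ht ?_
      obtain ⟨i, j, u⟩ := t
      simp only at h1 h2 hy1 hy2
      subst h1 h2
      rw [mem_bigTriangle_up]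
      simp; omega
    · intro y hy t ht
      exact ⟨hsub y (by simp [hy]) ht, fun h => Set.disjoint_left.1 (hdis.1 y hy) h ht⟩

/-! ### Centrally symmetric tilings and crossing lozenges -/

theorem rotate_rotate (c : ℤ × ℤ) (t : UnitTriangle) : (t.rotate c).rotate c = t := by
  obtain ⟨i, j, u⟩ := t
  simp [UnitTriangle.rotate]
  omega

theorem rotate_mem_nbrs {c : ℤ × ℤ} {s t : UnitTriangle} (h : s ∈ t.nbrs) :
    s.rotate c ∈ (t.rotate c).nbrs := by
  obtain ⟨i, j, u⟩ := t
  cases u <;> simp at h <;> rcases h with rfl | rfl | rfl <;> simp [UnitTriangle.rotate] <;> omega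

theorem image_rotate_image_rotate (c : ℤ × ℤ) (L : Finset UnitTriangle) :
    (L.image (UnitTriangle.rotate c)).image (UnitTriangle.rotate c) = L := by
  rw [Finset.image_image]
  have : UnitTriangle.rotate c ∘ UnitTriangle.rotate c = id := funext (rotate_rotate c)
  rw [this, Finset.image_id]

theorem mem_image_rotate {c : ℤ × ℤ} {L : Finset UnitTriangle} {t : UnitTriangle} :
    t ∈ L.image (UnitTriangle.rotate c) ↔ t.rotate c ∈ L := by
  rw [Finset.mem_image]
  constructor
  · rintro ⟨s, hs, rfl⟩
    rwa [rotate_rotate]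
  · exact fun h => ⟨_, h, rotate_rotate c t⟩

theorem IsLozenge.image_rotate {c : ℤ × ℤ} {L : Finset UnitTriangle} (hL : IsLozenge L) :
    IsLozenge (L.image (UnitTriangle.rotate c)) := by
  obtain ⟨s, t, h, rfl⟩ := hL
  rw [adjacent_iff_mem_nbrs] at h
  rw [Finset.image_insert, Finset.image_singleton, Finset.pair_comm]
  exact isLozenge_pair (rotate_mem_nbrs h)

/-- The lozenge crossing the line `v = h` at position `p`. -/
def crossingLozenge (h p : ℤ) : Finset UnitTriangle :=
  {⟨p, h, true⟩, ⟨p, h - 1, false⟩}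

theorem isLozenge_crossingLozenge (h p : ℤ) : IsLozenge (crossingLozenge h p) :=
  isLozenge_pair (by simp)

theorem mem_crossingLozenge {h p : ℤ} {t : UnitTriangle} :
    t ∈ crossingLozenge h p ↔ t = ⟨p, h, true⟩ ∨ t = ⟨p, h - 1, false⟩ := by
  simp [crossingLozenge]

/-- The rotation preserves the axis `v = h` and swaps its sides. The unit segment from `p` to `p +
1` goes to the one starting at `c.1 - 1 - p`, whence the shift by one. -/
theorem image_rotate_crossingLozenge {c : ℤ × ℤ} {h : ℤ} (hc : c.2 = 2 * h) (p : ℤ) :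
    (crossingLozenge h p).image (UnitTriangle.rotate c) = crossingLozenge h (c.1 - 1 - p) := by
  have h1 : (c.1 - p - 1) = c.1 - 1 - p := by ring
  have h2 : c.2 - h - 1 = h - 1 := by omega
  have h3 : c.2 - (h - 1) - 1 = h := by omega
  rw [crossingLozenge, crossingLozenge, Finset.image_insert, Finset.image_singleton]
  simp only [UnitTriangle.rotate, h1, h2, h3]
  exact Finset.pair_comm _ _

theorem IsLozenge.above_or_below_or_crossing {L : Finset UnitTriangle} (hL : IsLozenge L) (h : ℤ) :
    (∀ t ∈ L, h ≤ t.j) ∨ (∀ t ∈ L, t.j < h) ∨ ∃ p, L = crossingLozenge h p := by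
  obtain ⟨s, t, hst, rfl⟩ := hL
  rw [adjacent_iff_mem_nbrs] at hst
  obtain ⟨i, j, u⟩ := t
  simp only [Finset.forall_mem_insert, Finset.mem_singleton, forall_eq]
  cases u
  · simp at hst
    rcases hst with rfl | rfl | rfl
    · rcases le_or_gt h j with hj | hj
      · left; simp [hj]
      · right; left; simp [hj]
    · rcases le_or_gt h j with hj | hj
      · left; simp [hj]
      · right; left; simp [hj]
    · rcases lt_trichotomy (j + 1) h with hj | hj | hj
      · right; left; simp; omega
      · right; right
        refine ⟨i, ?_⟩
        subst hj
        simp [crossingLozenge]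
      · left; simp; omega
  · simp at hst
    rcases hst with rfl | rfl | rfl
    · rcases le_or_gt h j with hj | hj
      · left; simp [hj]
      · right; left; simp [hj]
    · rcases le_or_gt h j with hj | hj
      · left; simp [hj]
      · right; left; simp [hj]
    · rcases lt_trichotomy j h with hj | hj | hj
      · right; left; simp; omega
      · right; right
        refine ⟨i, ?_⟩
        subst hj
        rw [crossingLozenge, Finset.pair_comm]
      · left; simp; omega

section split
variable {c : ℤ × ℤ} {h : ℤ} {R : Set UnitTriangle} {X : Finset ℤ}

/-- The part of the region `R` above the line `v = h`, without the unit triangles along this line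
at the positions in `X`. -/
def upperPart (R : Set UnitTriangle) (h : ℤ) (X : Set ℤ) : Set UnitTriangle :=
  {t ∈ R | h ≤ t.j} \ baseUps h X

/-- The centrally symmetric tiling determined by its lozenges above the axis and the positions of
the lozenges crossing the axis. -/
def symmExtension (c : ℤ × ℤ) (h : ℤ) (X : Finset ℤ) (T : Set (Finset UnitTriangle)) :
    Set (Finset UnitTriangle) :=
  {L | L ∈ T ∨ L.image (UnitTriangle.rotate c) ∈ T ∨ ∃ p ∈ X, L = crossingLozenge h p}

theorem rotate_mem_symmExtension (hc : c.2 = 2 * h) (hX : ∀ p ∈ X, c.1 - 1 - p ∈ X)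
    {T : Set (Finset UnitTriangle)} {L : Finset UnitTriangle} (hL : L ∈ symmExtension c h X T) :
    L.image (UnitTriangle.rotate c) ∈ symmExtension c h X T := by
  rcases hL with hL | hL | ⟨p, hp, rfl⟩
  · right; left
    rwa [image_rotate_image_rotate]
  · left; exact hL
  · right; right
    exact ⟨_, hX p hp, image_rotate_crossingLozenge hc p⟩

theorem isTiling_upperPart {T : Set (Finset UnitTriangle)} (hT : IsTiling R T)
    (hX : ∀ p, p ∈ X ↔ crossingLozenge h p ∈ T) :
    IsTiling (upperPart R h X) {L ∈ T | ∀ t ∈ L, h ≤ t.j} := by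
  constructor
  · rintro L ⟨hL, hab⟩
    refine ⟨(hT.1 L hL).1, fun t ht => ⟨⟨(hT.1 L hL).2 ht, hab t ht⟩, ?_⟩⟩
    rintro ⟨h1, h2, h3⟩
    have h4 := (hX _).1 h3
    have h5 := hT.eq_of_mem hL h4 ht (by
      rw [mem_crossingLozenge]; left
      obtain ⟨i, j, u⟩ := t
      simp only at h1 h2
      rw [h1, h2])
    have := hab ⟨t.i, h - 1, false⟩ (by rw [h5, mem_crossingLozenge]; simp)
    simp at this
  · rintro t ⟨⟨htR, hth⟩, htX⟩
    obtain ⟨L, ⟨hL, htL⟩, huniq⟩ := hT.2 t htR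
    refine ⟨L, ⟨⟨hL, ?_⟩, htL⟩, fun L' hL' => huniq L' ⟨hL'.1.1, hL'.2⟩⟩
    rcases (hT.1 L hL).1.above_or_below_or_crossing h with h1 | h1 | ⟨p, rfl⟩
    · exact h1
    · exact absurd (h1 t htL) (not_lt.2 hth)
    · exfalso
      rw [mem_crossingLozenge] at htL
      rcases htL with rfl | rfl
      · exact htX ⟨rfl, rfl, (hX p).2 hL⟩
      · simp at hth

/-- Triangles above the axis are covered by `T` or by a crossing lozenge, never by a rotated lozenge
of `T`. Unique coverage below the axis follows by rotating. -/
theorem isTiling_symmExtension (hc : c.2 = 2 * h) (hR : ∀ t ∈ R, t.rotate c ∈ R)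
    (hX : ∀ p ∈ X, c.1 - 1 - p ∈ X)
    (hXR : ∀ p ∈ X, (⟨p, h, true⟩ : UnitTriangle) ∈ R ∧ (⟨p, h - 1, false⟩ : UnitTriangle) ∈ R)
    {T : Set (Finset UnitTriangle)} (hT : IsTiling (upperPart R h X) T) :
    IsTiling R (symmExtension c h X T) := by
  have habove : ∀ L ∈ T, ∀ t ∈ L, h ≤ t.j := fun L hL t ht => ((hT.1 L hL).2 ht).1.2
  constructor
  · rintro L (hL | hL | ⟨p, hp, rfl⟩)
    · exact ⟨(hT.1 L hL).1, fun t ht => ((hT.1 L hL).2 ht).1.1⟩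
    · refine ⟨?_, fun t ht => ?_⟩
      · have := (hT.1 _ hL).1.image_rotate (c := c)
        rwa [image_rotate_image_rotate] at this
      · have h1 := ((hT.1 _ hL).2 (Finset.mem_image_of_mem (UnitTriangle.rotate c) ht)).1.1
        have := hR _ h1
        rwa [rotate_rotate] at this
    · refine ⟨isLozenge_crossingLozenge h p, fun t ht => ?_⟩
      rw [Finset.mem_coe, mem_crossingLozenge] at ht
      rcases ht with rfl | rfl
      · exact (hXR p hp).1
      · exact (hXR p hp).2
  · have key : ∀ t ∈ R, h ≤ t.j → ∃! L, L ∈ symmExtension c h X T ∧ t ∈ L := by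
      intro t htR hth
      have hrot : ∀ L : Finset UnitTriangle, L.image (UnitTriangle.rotate c) ∈ T → t ∉ L := by
        intro L hL htL
        have := habove _ hL _ (Finset.mem_image_of_mem (UnitTriangle.rotate c) htL)
        simp [UnitTriangle.rotate] at this
        omega
      by_cases htX : t ∈ baseUps h X
      · obtain ⟨i, j, u⟩ := t
        obtain ⟨rfl, rfl, hi⟩ := htX
        refine ⟨crossingLozenge j i, ⟨Or.inr (Or.inr ⟨i, hi, rfl⟩), ?_⟩, ?_⟩
        · simp [mem_crossingLozenge]
        · rintro L ⟨hL | hL | ⟨p, hp, rfl⟩, htL⟩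
          · exact absurd ⟨rfl, rfl, hi⟩ ((hT.1 L hL).2 htL).2
          · exact absurd htL (hrot L hL)
          · simp [mem_crossingLozenge] at htL
            rw [htL]
      · obtain ⟨L, ⟨hL, htL⟩, huniq⟩ := hT.2 t ⟨⟨htR, hth⟩, htX⟩
        refine ⟨L, ⟨Or.inl hL, htL⟩, ?_⟩
        rintro L' ⟨hL' | hL' | ⟨p, hp, rfl⟩, htL'⟩
        · exact huniq L' ⟨hL', htL'⟩
        · exact absurd htL' (hrot L' hL')
        · rw [mem_crossingLozenge] at htL'
          rcases htL' with rfl | rfl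
          · exact absurd ⟨rfl, rfl, hp⟩ htX
          · simp at hth
    intro t htR
    rcases le_or_gt h t.j with hth | hth
    · exact key t htR hth
    · obtain ⟨L, ⟨hL, htL⟩, huniq⟩ := key _ (hR t htR) (by simp [UnitTriangle.rotate]; omega)
      refine ⟨L.image (UnitTriangle.rotate c), ⟨rotate_mem_symmExtension hc hX hL, ?_⟩, ?_⟩
      · rwa [mem_image_rotate]
      · rintro L' ⟨hL', htL'⟩
        rw [← huniq _ ⟨rotate_mem_symmExtension hc hX hL',
          Finset.mem_image_of_mem _ htL'⟩, image_rotate_image_rotate]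

/-- Restricting to the lozenges above the axis is inverse to `symmExtension`: those below are
rotations of those above, and the crossing ones are prescribed by `X`. -/
theorem ncard_symm_tilings_with_crossings (hc : c.2 = 2 * h) (hR : ∀ t ∈ R, t.rotate c ∈ R)
    (hX : ∀ p ∈ X, c.1 - 1 - p ∈ X)
    (hXR : ∀ p ∈ X, (⟨p, h, true⟩ : UnitTriangle) ∈ R ∧ (⟨p, h - 1, false⟩ : UnitTriangle) ∈ R) :
    {T | (IsTiling R T ∧ ∀ L ∈ T, L.image (UnitTriangle.rotate c) ∈ T) ∧
      ∀ p, p ∈ X ↔ crossingLozenge h p ∈ T}.ncard = numTilings (upperPart R h X) := by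
  have hext : ∀ T, (IsTiling R T ∧ ∀ L ∈ T, L.image (UnitTriangle.rotate c) ∈ T) →
      (∀ p, p ∈ X ↔ crossingLozenge h p ∈ T) →
      symmExtension c h X {L ∈ T | ∀ t ∈ L, h ≤ t.j} = T := by
    rintro T ⟨hT, hsymm⟩ hTX
    ext L
    constructor
    · rintro (hL | hL | ⟨p, hp, rfl⟩)
      · exact hL.1
      · have := hsymm _ hL.1
        rwa [image_rotate_image_rotate] at this
      · exact (hTX p).1 hp
    · intro hL
      rcases (hT.1 L hL).1.above_or_below_or_crossing h with h1 | h1 | ⟨p, rfl⟩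
      · exact Or.inl ⟨hL, h1⟩
      · refine Or.inr (Or.inl ⟨hsymm L hL, fun t ht => ?_⟩)
        rw [mem_image_rotate] at ht
        have := h1 _ ht
        simp [UnitTriangle.rotate] at this
        omega
      · exact Or.inr (Or.inr ⟨p, (hTX p).2 hL, rfl⟩)
  refine Set.ncard_congr (fun T _ => {L ∈ T | ∀ t ∈ L, h ≤ t.j}) ?_ ?_ ?_
  · rintro T ⟨⟨hT, _⟩, hTX⟩
    exact isTiling_upperPart hT hTX
  · rintro T T' ⟨hT, hTX⟩ ⟨hT', hTX'⟩ heq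
    rw [← hext T hT hTX, ← hext T' hT' hTX', heq]
  · intro T hT
    have habove : ∀ L ∈ T, ∀ t ∈ L, h ≤ t.j := fun L hL t ht => ((hT.1 L hL).2 ht).1.2
    have hnot : ∀ L : Finset UnitTriangle, L.image (UnitTriangle.rotate c) ∈ T → ∀ t ∈ L, t.j < h := by
      intro L hL t ht
      have := habove _ hL _ (Finset.mem_image_of_mem (UnitTriangle.rotate c) ht)
      simp [UnitTriangle.rotate] at this
      omega
    refine ⟨symmExtension c h X T, ⟨⟨isTiling_symmExtension hc hR hX hXR hT,
      fun L hL => rotate_mem_symmExtension hc hX hL⟩, fun p => ⟨fun hp => Or.inr (Or.inr ⟨p, hp, rfl⟩), ?_⟩⟩, ?_⟩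
    · rintro (hp | hp | ⟨q, hq, heq⟩)
      · have := habove _ hp ⟨p, h - 1, false⟩ (by simp [mem_crossingLozenge])
        simp at this
      · have := hnot _ hp ⟨p, h, true⟩ (by simp [mem_crossingLozenge])
        simp at this
      · have h1 : (⟨p, h, true⟩ : UnitTriangle) ∈ crossingLozenge h q := by
          rw [← heq]; simp [mem_crossingLozenge]
        simp [mem_crossingLozenge] at h1
        rwa [h1]
    · ext L
      constructor
      · rintro ⟨hL | hL | ⟨p, hp, rfl⟩, hab⟩
        · exact hL
        · obtain ⟨s, t, -, heq⟩ := (hT.1 _ hL).1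
          have hs : s ∈ L.image (UnitTriangle.rotate c) := by rw [heq]; simp
          rw [mem_image_rotate] at hs
          exact absurd (hab _ hs) (not_le.2 (hnot L hL _ hs))
        · have := hab ⟨p, h - 1, false⟩ (by simp [mem_crossingLozenge])
          simp at this
      · exact fun hL => ⟨Or.inl hL, habove L hL⟩

/-- A centrally symmetric tiling is given by the lozenges crossing the horizontal axis and a tiling
of the rest of the upper half. -/
theorem numSymmTilings_eq_sum (hc : c.2 = 2 * h) (hfin : R.Finite) (hR : ∀ t ∈ R, t.rotate c ∈ R)
    (A : Finset ℤ) (hA : ∀ p, p ∈ A ↔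
      (⟨p, h, true⟩ : UnitTriangle) ∈ R ∧ (⟨p, h - 1, false⟩ : UnitTriangle) ∈ R) :
    numSymmTilings c R =
      ∑ X ∈ A.powerset with ∀ p ∈ X, c.1 - 1 - p ∈ X, numTilings (upperPart R h X) := by
  have h1 : {T | IsTiling R T ∧ ∀ L ∈ T, L.image (UnitTriangle.rotate c) ∈ T} =
      ⋃ X ∈ ({X ∈ A.powerset | ∀ p ∈ X, c.1 - 1 - p ∈ X} : Set (Finset ℤ)),
        {T | (IsTiling R T ∧ ∀ L ∈ T, L.image (UnitTriangle.rotate c) ∈ T) ∧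
          ∀ p, p ∈ X ↔ crossingLozenge h p ∈ T} := by
    classical
    ext T
    simp only [Set.mem_iUnion, exists_prop, Set.mem_ofPred_eq, Finset.mem_powerset]
    refine ⟨fun hT => ?_, fun ⟨X, _, h⟩ => h.1⟩
    have hcross : ∀ p, crossingLozenge h p ∈ T → p ∈ A := fun p hp => by
      have := (hT.1.1 _ hp).2
      exact (hA p).2 ⟨this (by simp [mem_crossingLozenge]), this (by simp [mem_crossingLozenge])⟩
    refine ⟨{p ∈ A | crossingLozenge h p ∈ T}, ⟨Finset.filter_subset _ _, fun p hp => ?_⟩, hT,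
      fun p => ?_⟩
    · rw [Finset.mem_filter] at hp ⊢
      have := hT.2 _ hp.2
      rw [image_rotate_crossingLozenge hc] at this
      exact ⟨hcross _ this, this⟩
    · rw [Finset.mem_filter]
      exact ⟨fun h => h.2, fun h => ⟨hcross _ h, h⟩⟩
  have h2 : ({X ∈ A.powerset | ∀ p ∈ X, c.1 - 1 - p ∈ X} : Set (Finset ℤ)) =
      (({X ∈ A.powerset | ∀ p ∈ X, c.1 - 1 - p ∈ X} : Finset (Finset ℤ)) : Set (Finset ℤ)) := by
    ext X; simp
  rw [numSymmTilings, h1, h2, Set.Finite.ncard_biUnion (Finset.finite_toSet _),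
    finsum_mem_coe_finset]
  · refine Finset.sum_congr rfl fun X hX => ?_
    rw [Finset.mem_filter, Finset.mem_powerset] at hX
    exact ncard_symm_tilings_with_crossings hc hR hX.2 fun p hp => (hA p).1 (hX.1 hp)
  · exact fun X _ => (finite_tilings hfin).subset fun T hT => hT.1.1
  · intro X _ X' _ hne
    refine Set.disjoint_left.2 fun T hT hT' => hne ?_
    ext p
    rw [hT.2, hT'.2]

end split

/-! ### Products of distances between sets of positions -/

/-- The product of the distances between the elements of two finite sets of integers. -/
def crossDist (S T : Finset ℤ) : ℕ :=
  ∏ s ∈ S, ∏ t ∈ T, (s - t).natAbs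

theorem crossDist_comm (S T : Finset ℤ) : crossDist S T = crossDist T S := by
  rw [crossDist, Finset.prod_comm]
  refine Finset.prod_congr rfl fun t _ => Finset.prod_congr rfl fun s _ => ?_
  omega

theorem crossDist_union_right {S T T' : Finset ℤ} (h : Disjoint T T') :
    crossDist S (T ∪ T') = crossDist S T * crossDist S T' := by
  simp only [crossDist, Finset.prod_union h, Finset.prod_mul_distrib]

theorem crossDist_union_left {S S' T : Finset ℤ} (h : Disjoint S S') :
    crossDist (S ∪ S') T = crossDist S T * crossDist S' T := by
  rw [crossDist, Finset.prod_union h]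
  rfl

theorem crossDist_pos {S T : Finset ℤ} (h : Disjoint S T) : 0 < crossDist S T :=
  Finset.prod_pos fun s hs => Finset.prod_pos fun t ht => by
    have : s ≠ t := fun e => Finset.disjoint_left.1 h hs (e ▸ ht)
    omega

theorem crossDist_image_sub (c : ℤ) (S T : Finset ℤ) :
    crossDist (S.image fun p => c - p) (T.image fun p => c - p) = crossDist S T := by
  have hinj : Function.Injective fun p : ℤ => c - p := fun a b h => by simpa using h
  simp only [crossDist, Finset.prod_image hinj.injOn]
  refine Finset.prod_congr rfl fun s _ => Finset.prod_congr rfl fun t _ => ?_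
  omega

theorem image_sub_image_sub (c : ℤ) (S : Finset ℤ) :
    (S.image fun p => c - p).image (fun p => c - p) = S := by
  have h : ((fun p => c - p) ∘ fun p => c - p) = (id : ℤ → ℤ) := by ext x; simp
  rw [Finset.image_image, h, Finset.image_id]

theorem image_sub_eq_self {c : ℤ} {X : Finset ℤ} (hX : ∀ p ∈ X, c - p ∈ X) :
    (X.image fun p => c - p) = X := by
  ext p
  rw [Finset.mem_image]
  constructor
  · rintro ⟨q, hq, rfl⟩
    exact hX q hq
  · exact fun hp => ⟨c - p, hX p hp, by ring⟩

/-- The distances from a symmetric set to a set `U` depend only on the symmetrization of `U`. -/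
theorem crossDist_sq_of_symm {c : ℤ} {X U F : Finset ℤ} (hX : ∀ p ∈ X, c - p ∈ X)
    (hd : Disjoint U (U.image fun p => c - p)) (hF : U ∪ (U.image fun p => c - p) = F) :
    crossDist X U ^ 2 = crossDist X F := by
  rw [← hF, crossDist_union_right hd, sq]
  congr 1
  -- The reflection preserves distances and fixes `X`, so `U` and its mirror image contribute
  -- equally.
  rw [← crossDist_image_sub c X U, image_sub_eq_self hX]

/-- This independence of the shape of the ferns is what makes the sum over crossing sets cancel in
the quotient. The squares agree, and natural square roots are unique. -/
theorem crossDist_eq_of_symm {c : ℤ} {X U V F : Finset ℤ} (hX : ∀ p ∈ X, c - p ∈ X)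
    (hU : Disjoint U (U.image fun p => c - p)) (hUF : U ∪ (U.image fun p => c - p) = F)
    (hV : Disjoint V (V.image fun p => c - p)) (hVF : V ∪ (V.image fun p => c - p) = F) :
    crossDist X U = crossDist X V :=
  Nat.pow_left_injective (n := 2) (by norm_num)
    ((crossDist_sq_of_symm hX hU hUF).trans (crossDist_sq_of_symm hX hV hVF).symm)

theorem vand_insert {a : ℤ} {S : Finset ℤ} (ha : a ∉ S) :
    vand (insert a S) = vand S * ∏ s ∈ S, (s - a).natAbs := by
  simp only [vand, Finset.prod_filter, Finset.prod_insert ha, lt_irrefl, if_false, one_mul,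
    Finset.prod_mul_distrib]
  rw [← mul_assoc, mul_comm]
  congr 1
  rw [← Finset.prod_mul_distrib]
  refine Finset.prod_congr rfl fun s hs => ?_
  have : s ≠ a := fun e => ha (e ▸ hs)
  split_ifs <;> omega

theorem vand_union {S T : Finset ℤ} (h : Disjoint S T) :
    vand (S ∪ T) = vand S * vand T * crossDist S T := by
  induction T using Finset.induction_on with
  | empty => simp [vand, crossDist]
  | insert a T ha ih =>
    rw [Finset.disjoint_insert_right] at h
    have h1 : a ∉ S ∪ T := by simp [h.1, ha]
    have h2 : insert a T = T ∪ {a} := by rw [Finset.union_comm, Finset.insert_eq]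
    have h3 : crossDist S {a} = ∏ s ∈ S, (s - a).natAbs := by simp [crossDist]
    rw [Finset.union_insert, vand_insert h1, ih h.2, vand_insert ha, Finset.prod_union h.2, h2,
      crossDist_union_right (by simpa using ha), h3]
    ring

theorem vand_pos (S : Finset ℤ) : 0 < vand S :=
  Finset.prod_pos fun s _ => Finset.prod_pos fun t ht => by
    rw [Finset.mem_filter] at ht
    omega

theorem vand_image_add (k : ℤ) (S : Finset ℤ) : vand (S.image (· + k)) = vand S := by
  have hinj : Function.Injective fun p : ℤ => p + k := fun a b h => by simpa using h
  simp only [vand, Finset.prod_filter, Finset.prod_image hinj.injOn]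
  simp

/-! ### Hyperfactorials and distances to intervals -/

theorem Ico_add_succ (p : ℤ) (n : ℕ) :
    Finset.Ico p (p + (n + 1 : ℕ)) = insert (p + n) (Finset.Ico p (p + n)) := by
  ext x
  simp only [Finset.mem_Ico, Finset.mem_insert]
  omega

theorem hyperfact_succ (n : ℕ) : hyperfact (n + 1) = hyperfact n * n.factorial :=
  Finset.prod_range_succ _ _

theorem hyperfact_pos (n : ℕ) : 0 < hyperfact n :=
  Finset.prod_pos fun i _ => i.factorial_pos

theorem vand_Ico (p : ℤ) (n : ℕ) : vand (Finset.Ico p (p + n)) = hyperfact n := by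
  induction n with
  | zero => simp [vand, hyperfact]
  | succ n ih =>
    rw [Ico_add_succ, vand_insert (by simp), ih, hyperfact_succ]
    congr 1
    clear ih
    induction n generalizing p with
    | zero => simp
    | succ n ih =>
      have h1 : Finset.Ico p (p + (n + 1 : ℕ)) = insert p (Finset.Ico (p + 1) (p + 1 + n)) := by
        ext x
        simp only [Finset.mem_Ico, Finset.mem_insert]
        omega
      have h2 := ih (p + 1)
      rw [h1, Finset.prod_insert (by simp), Nat.factorial_succ, ← h2]
      congr 1
      · omega
      · refine Finset.prod_congr rfl fun x _ => ?_
        omega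

/-- The quotient of hyperfactorials governing the distances to `H` consecutive integers. -/
def hyperfactRatio (H t : ℕ) : ℚ :=
  hyperfact (t + H) / hyperfact t

theorem hyperfactRatio_ne_zero (H t : ℕ) : hyperfactRatio H t ≠ 0 := by
  have h1 := (hyperfact_pos (t + H)).ne'
  have h2 := (hyperfact_pos t).ne'
  rw [hyperfactRatio]
  positivity

/-- The distances from `u` to `-1, …, -H` are `u + 1, …, u + H`. -/
theorem crossDist_singleton_Ico (u H : ℕ) :
    crossDist {(u : ℤ)} (Finset.Ico (-H : ℤ) 0) * u.factorial = (u + H).factorial := by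
  simp only [crossDist, Finset.prod_singleton]
  induction H with
  | zero => simp
  | succ H ih =>
    have h1 : Finset.Ico (-(H + 1 : ℕ) : ℤ) 0 = insert (-(H + 1 : ℕ) : ℤ) (Finset.Ico (-H : ℤ) 0) := by
      ext x
      simp only [Finset.mem_Ico, Finset.mem_insert]
      omega
    rw [h1, Finset.prod_insert (by simp), mul_assoc, ih, ← add_assoc, Nat.factorial_succ]
    congr 1

/-- A product of quotients `(u + H)! / u!` over consecutive `u`; each is the ratio of two successive
values of `hyperfactRatio H`, so the product telescopes. -/
theorem crossDist_Ico_Ico (p n H : ℕ) :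
    (crossDist (Finset.Ico (p : ℤ) (p + n)) (Finset.Ico (-H : ℤ) 0) : ℚ) =
      hyperfactRatio H (p + n) / hyperfactRatio H p := by
  induction n with
  | zero => simp [crossDist, hyperfactRatio_ne_zero]
  | succ n ih =>
    have h := crossDist_singleton_Ico (p + n) H
    rw [Ico_add_succ, Finset.insert_eq, crossDist_union_left (by simp), Nat.cast_mul, ih]
    have h' : (crossDist {((p : ℤ) + n)} (Finset.Ico (-H : ℤ) 0) : ℚ) =
        (p + n + H).factorial / (p + n).factorial := by
      rw [eq_div_iff (by positivity)]
      push_cast at h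
      exact_mod_cast h
    rw [h', ← mul_div_assoc]
    congr 1
    have e1 : p + (n + 1) + H = p + n + H + 1 := by ring
    rw [hyperfactRatio, hyperfactRatio, e1, ← add_assoc p n 1, hyperfact_succ, hyperfact_succ]
    have h1 : (hyperfact (p + n) : ℚ) ≠ 0 := by exact_mod_cast (hyperfact_pos _).ne'
    have h2 : ((p + n).factorial : ℚ) ≠ 0 := by positivity
    push_cast
    field_simp

/-! ### Positions of the lobes of a fern -/

/-- The positions of the up-pointing lobes of a fern along its axis. -/
noncomputable def lobePositions (p : ℤ) (up : Bool) : List ℕ → Finset ℤ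
  | [] => ∅
  | n :: l => (if up then Finset.Ico p (p + n) else ∅) ∪ lobePositions (p + n) (!up) l

theorem lobePositions_subset (p : ℤ) (up : Bool) (l : List ℕ) :
    lobePositions p up l ⊆ Finset.Ico p (p + l.sum) := by
  induction l generalizing p up with
  | nil => simp [lobePositions]
  | cons n l ih =>
    intro x hx
    rw [lobePositions, Finset.mem_union] at hx
    rw [Finset.mem_Ico, List.sum_cons]
    rcases hx with hx | hx
    · split_ifs at hx
      · rw [Finset.mem_Ico] at hx; rw [Nat.cast_add]; omega
      · simp at hx
    · have := ih _ _ hx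
      rw [Finset.mem_Ico] at this
      rw [Nat.cast_add]; omega

theorem disjoint_Ico_lobePositions (p : ℤ) (n : ℕ) (up : Bool) (l : List ℕ) :
    Disjoint (Finset.Ico p (p + n)) (lobePositions (p + n) up l) := by
  rw [Finset.disjoint_left]
  intro x hx hx'
  have := lobePositions_subset _ _ _ hx'
  rw [Finset.mem_Ico] at this hx
  omega

theorem disjoint_lobePositions_not (p : ℤ) (up : Bool) (l : List ℕ) :
    Disjoint (lobePositions p up l) (lobePositions p (!up) l) := by
  induction l generalizing p up with
  | nil => simp [lobePositions]
  | cons n l ih =>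
    have h1 := disjoint_Ico_lobePositions p n up l
    have h2 := disjoint_Ico_lobePositions p n (!up) l
    have h3 := ih (p + n) (!up)
    rw [lobePositions, lobePositions]
    cases up
    · simp at h1 h2 h3 ⊢
      exact ⟨h2.symm, h3⟩
    · simp at h1 h2 h3 ⊢
      exact ⟨h1, h3⟩

theorem lobePositions_union_not (p : ℤ) (up : Bool) (l : List ℕ) :
    lobePositions p up l ∪ lobePositions p (!up) l = Finset.Ico p (p + l.sum) := by
  induction l generalizing p up with
  | nil => simp [lobePositions]
  | cons n l ih =>
    have h1 : Finset.Ico p (p + (n :: l).sum) =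
        Finset.Ico p (p + n) ∪ Finset.Ico (p + n) (p + n + l.sum) := by
      ext x
      simp only [Finset.mem_Ico, Finset.mem_union, List.sum_cons, Nat.cast_add]
      omega
    rw [h1, ← ih (p + n) up, lobePositions, lobePositions]
    ext x
    cases up <;> simp <;> tauto

theorem card_lobePositions_add_not (p : ℤ) (up : Bool) (l : List ℕ) :
    (lobePositions p up l).card + (lobePositions p (!up) l).card = l.sum := by
  rw [← Finset.card_union_of_disjoint (disjoint_lobePositions_not p up l),
    lobePositions_union_not, Int.card_Ico]
  omega

theorem lobePositions_append (p : ℤ) (up : Bool) (l l' : List ℕ) :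
    lobePositions p up (l ++ l') =
      lobePositions p up l ∪ lobePositions (p + l.sum) (up ^^ l.length.bodd) l' := by
  induction l generalizing p up with
  | nil => simp [lobePositions]
  | cons n l ih =>
    rw [List.cons_append, lobePositions, ih, lobePositions, List.sum_cons, List.length_cons,
      Finset.union_assoc]
    congr 3
    · push_cast; ring
    · simp

theorem image_add_lobePositions (p k : ℤ) (up : Bool) (l : List ℕ) :
    (lobePositions p up l).image (· + k) = lobePositions (p + k) up l := by
  induction l generalizing p up with
  | nil => simp [lobePositions]
  | cons n l ih =>
    rw [lobePositions, Finset.image_union, ih, lobePositions]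
    congr 1
    · cases up
      · simp
      · simp only [if_true]
        ext x
        simp only [Finset.mem_image, Finset.mem_Ico]
        exact ⟨fun ⟨y, hy, e⟩ => by omega, fun hx => ⟨x - k, by omega, by ring⟩⟩
    · congr 1; ring

/-- Reflection reverses the order of the lobes. The colour of the new first lobe is that of the old
last one, which depends on the parity of the length. -/
theorem image_sub_lobePositions (c p : ℤ) (up : Bool) (l : List ℕ) :
    (lobePositions p up l).image (fun x => c - x) =
      lobePositions (c + 1 - p - l.sum) ((!up) ^^ l.length.bodd) l.reverse := by
  induction l generalizing p up with
  | nil => simp [lobePositions]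
  | cons n l ih =>
    rw [lobePositions, Finset.image_union, ih, List.reverse_cons, lobePositions_append,
      Finset.union_comm, List.sum_cons, List.length_cons, List.sum_reverse, List.length_reverse]
    congr 1
    · congr 1
      · push_cast; ring
      · simp
    · have h1 : (((!up) ^^ (l.length + 1).bodd) ^^ l.length.bodd) = up := by
        cases up <;> cases h : l.length.bodd <;> simp [h]
      rw [h1]
      simp only [lobePositions, Finset.union_empty]
      cases up
      · simp
      · simp only [if_true]
        ext x
        simp only [Finset.mem_image, Finset.mem_Ico]
        push_cast
        exact ⟨fun ⟨y, hy, e⟩ => by omega, fun hx => ⟨c - x, by omega, by ring⟩⟩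

theorem oddSum_eq_card (p : ℤ) : ∀ l : List ℕ, oddSum l = (lobePositions p true l).card
  | [] => by simp [oddSum, lobePositions]
  | [n] => by simp [oddSum, lobePositions]
  | n :: m :: l => by
    rw [oddSum, oddSum_eq_card (p + n + m) l, lobePositions, lobePositions]
    have h := lobePositions_subset (p + n + m) true l
    rw [if_pos rfl, if_neg (by simp), Finset.empty_union, Finset.card_union_of_disjoint]
    · simp
    · rw [Finset.disjoint_left]
      intro x hx hx'
      have := h hx'
      rw [Finset.mem_Ico] at hx this
      omega

theorem baseTriangles_eq (p : ℤ) : ∀ l : List ℕ,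
    baseTriangles p l = baseUps 0 (lobePositions p true l)
  | [] => by simp [baseTriangles, lobePositions, baseUps]
  | [n] => by
    ext t
    simp [baseTriangles, lobePositions, baseUps]
  | n :: m :: l => by
    rw [baseTriangles, baseTriangles_eq (p + n + m) l, lobePositions, lobePositions]
    ext t
    simp [baseUps]
    tauto

/-- Every second lobe contributes the quotient of `hyperfactRatio` at its two endpoints, and the
endpoints are partial sums of the list. -/
theorem crossDist_lobePositions (m H : ℕ) (k : ℕ) (l : List ℕ) (hl : l.length = 2 * k) :
    (crossDist (lobePositions m true l) (Finset.Ico (-H : ℤ) 0) : ℚ) =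
      ∏ i ∈ Finset.range k, hyperfactRatio H (m + (l.take (2 * i + 1)).sum) /
        hyperfactRatio H (m + (l.take (2 * i)).sum) ∧
    (crossDist (lobePositions m false l) (Finset.Ico (-H : ℤ) 0) : ℚ) =
      ∏ i ∈ Finset.range k, hyperfactRatio H (m + (l.take (2 * i + 2)).sum) /
        hyperfactRatio H (m + (l.take (2 * i + 1)).sum) := by
  induction k generalizing m l with
  | zero =>
    obtain rfl : l = [] := List.length_eq_zero_iff.1 hl
    simp [lobePositions, crossDist]
  | succ k ih =>
    match l, hl with
    | a :: b :: l, hl =>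
      have ih' := ih (m + a + b) l (by simp at hl; omega)
      have hcast : ((m + a + b : ℕ) : ℤ) = (m : ℤ) + a + b := by push_cast; ring
      rw [hcast] at ih'
      constructor
      · have hd : Disjoint (Finset.Ico (m : ℤ) (m + a)) (lobePositions (m + a + b) true l) := by
          rw [Finset.disjoint_left]
          intro x hx hx'
          have := lobePositions_subset _ _ _ hx'
          rw [Finset.mem_Ico] at hx this
          omega
        rw [lobePositions, lobePositions, if_pos rfl, if_neg (by simp), Finset.empty_union,
          Bool.not_true, Bool.not_false, crossDist_union_left hd, Nat.cast_mul, ih'.1,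
          Finset.prod_range_succ', mul_comm, crossDist_Ico_Ico]
        congr 1
        · refine Finset.prod_congr rfl fun i _ => ?_
          have e1 : 2 * (i + 1) + 1 = 2 * i + 1 + 1 + 1 := by ring
          have e2 : 2 * (i + 1) = 2 * i + 1 + 1 := by ring
          rw [e1, e2]
          simp only [List.take_succ_cons, List.sum_cons]
          simp only [add_assoc]
      · have hd : Disjoint (Finset.Ico ((m : ℤ) + a) (m + a + b))
            (lobePositions (m + a + b) false l) := disjoint_Ico_lobePositions _ _ _ _
        have hI := crossDist_Ico_Ico (m + a) b H
        push_cast at hI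
        rw [lobePositions, lobePositions, if_neg (by simp), Bool.not_false, if_pos rfl,
          Finset.empty_union,
          Bool.not_true, crossDist_union_left hd, Nat.cast_mul, ih'.2,
          Finset.prod_range_succ', mul_comm, hI]
        congr 1
        · refine Finset.prod_congr rfl fun i _ => ?_
          have e1 : 2 * (i + 1) + 2 = 2 * i + 2 + 1 + 1 := by ring
          have e2 : 2 * (i + 1) + 1 = 2 * i + 1 + 1 + 1 := by ring
          rw [e1, e2]
          simp only [List.take_succ_cons, List.sum_cons]
          simp only [add_assoc]
        · simp [add_assoc]

/-! ### Lobes as separate triangles -/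

/-- The bases of the up-pointing lobes of a fern, given by left endpoint and length. -/
def lobeIntervals (p : ℤ) (up : Bool) : List ℕ → List (ℤ × ℕ)
  | [] => []
  | n :: l => (if up then [(p, n)] else []) ++ lobeIntervals (p + n) (!up) l

theorem mem_lobePositions {p i : ℤ} {up : Bool} {l : List ℕ} :
    i ∈ lobePositions p up l ↔ ∃ x ∈ lobeIntervals p up l, x.1 ≤ i ∧ i < x.1 + x.2 := by
  induction l generalizing p up with
  | nil => simp [lobePositions, lobeIntervals]
  | cons n l ih =>
    cases up <;> simp [lobePositions, lobeIntervals, ih]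

theorem lobeIntervals_bounds {p : ℤ} {up : Bool} {l : List ℕ} {x : ℤ × ℕ}
    (hx : x ∈ lobeIntervals p up l) : p ≤ x.1 ∧ x.1 + x.2 ≤ p + l.sum := by
  induction l generalizing p up with
  | nil => simp [lobeIntervals] at hx
  | cons n l ih =>
    rw [List.sum_cons, Nat.cast_add]
    rw [lobeIntervals, List.mem_append] at hx
    rcases hx with hx | hx
    · cases up
      · simp at hx
      · simp at hx
        subst hx
        simp only
        omega
    · have := ih hx
      omega

theorem pairwise_lobeIntervals (p : ℤ) (up : Bool) (l : List ℕ) :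
    (lobeIntervals p up l).Pairwise fun x y : ℤ × ℕ => x.1 + x.2 ≤ y.1 := by
  induction l generalizing p up with
  | nil => simp [lobeIntervals]
  | cons n l ih =>
    cases up
    · simpa [lobeIntervals] using ih _ _
    · simp only [lobeIntervals, if_true, List.singleton_append, List.pairwise_cons]
      exact ⟨fun y hy => (lobeIntervals_bounds hy).1, ih _ _⟩

theorem mem_lobes {p h : ℤ} {up : Bool} {l : List ℕ} {t : UnitTriangle} :
    t ∈ lobes (p, h) up l ↔ (∃ x ∈ lobeIntervals p up l, t ∈ bigTriangle (x.1, h) x.2 true) ∨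
      ∃ x ∈ lobeIntervals p (!up) l, t ∈ bigTriangle (x.1, h) x.2 false := by
  induction l generalizing p up with
  | nil => simp [lobes, lobeIntervals]
  | cons n l ih =>
    cases up
    · simp only [lobes, lobeIntervals, ih, Set.mem_union]
      simpa using or_left_comm
    · simp only [lobes, lobeIntervals, ih, Set.mem_union]
      simpa using or_assoc.symm

theorem lt_of_mem_bigTriangle_down {p h : ℤ} {n : ℕ} {t : UnitTriangle}
    (ht : t ∈ bigTriangle (p, h) n false) : t.j < h := by
  obtain ⟨i, j, u⟩ := t
  exact (mem_bigTriangle_down.1 ht).2.1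

theorem rotate_mem_bigTriangle {c : ℤ × ℤ} {q h : ℤ} (hc : c.2 = 2 * h) {n : ℕ} {t : UnitTriangle}
    {b : Bool} : t.rotate c ∈ bigTriangle (q, h) n b ↔ t ∈ bigTriangle (c.1 - q - n, h) n (!b) := by
  obtain ⟨i, j, u⟩ := t
  cases b <;> cases u <;>
    simp [UnitTriangle.rotate, mem_bigTriangle_up, mem_bigTriangle_down] <;> omega

theorem disjoint_bigTriangle {p q h : ℤ} {n n' : ℕ} (hpq : p + n ≤ q) :
    Disjoint (bigTriangle (p, h) n true) (bigTriangle (q, h) n' true) := by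
  rw [Set.disjoint_left]
  rintro ⟨i, j, u⟩ h1 h2
  rw [mem_bigTriangle_up] at h1 h2
  cases u <;> simp at h1 h2 <;> omega

/-! ### The pair of ferns along the axis -/

/-- The positions along the axis of the up-pointing lobes of the two ferns, the first of which has
its base point at position `m`. -/
noncomputable def upPositions (m : ℤ) (a : List ℕ) : Finset ℤ :=
  lobePositions m true a ∪ (lobePositions m false a).image fun p => 2 * m + 2 * a.sum - p

/-- The bases of the up-pointing lobes of the two ferns. -/
def upIntervals (m : ℤ) (a : List ℕ) : List (ℤ × ℕ) :=
  lobeIntervals m true a ++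
    (lobeIntervals m false a).map fun x => (2 * m + 2 * a.sum + 1 - x.1 - x.2, x.2)

/-- The positions along the axis covered by the two ferns. -/
noncomputable def fernPositions (m : ℤ) (s : ℕ) : Finset ℤ :=
  Finset.Ico m (m + s) ∪ Finset.Ico (m + s + 1) (m + 2 * s + 1)

theorem mem_upPositions {m i : ℤ} {a : List ℕ} :
    i ∈ upPositions m a ↔ ∃ x ∈ upIntervals m a, x.1 ≤ i ∧ i < x.1 + x.2 := by
  rw [upPositions, upIntervals, Finset.mem_union, Finset.mem_image, mem_lobePositions]
  simp only [mem_lobePositions, List.mem_append, List.mem_map]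
  constructor
  · rintro (⟨x, hx, h⟩ | ⟨j, ⟨x, hx, h⟩, rfl⟩)
    · exact ⟨x, Or.inl hx, h⟩
    · exact ⟨_, Or.inr ⟨x, hx, rfl⟩, by simp only; omega⟩
  · rintro ⟨x, hx | ⟨y, hy, rfl⟩, h⟩
    · exact Or.inl ⟨x, hx, h⟩
    · simp only at h
      exact Or.inr ⟨2 * m + 2 * a.sum - i, ⟨y, hy, by omega⟩, by ring⟩

theorem upIntervals_bounds {m : ℤ} {a : List ℕ} {x : ℤ × ℕ} (hx : x ∈ upIntervals m a) :
    m ≤ x.1 ∧ x.1 + x.2 ≤ m + 2 * a.sum + 1 ∧ x.2 ≤ a.sum := by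
  rw [upIntervals, List.mem_append, List.mem_map] at hx
  rcases hx with hx | ⟨y, hy, rfl⟩
  · have := lobeIntervals_bounds hx
    omega
  · have := lobeIntervals_bounds hy
    simp only
    omega

theorem pairwise_upIntervals (m : ℤ) (a : List ℕ) :
    (upIntervals m a).Pairwise fun x y : ℤ × ℕ => x.1 + x.2 ≤ y.1 ∨ y.1 + y.2 ≤ x.1 := by
  rw [upIntervals, List.pairwise_append, List.pairwise_map]
  refine ⟨(pairwise_lobeIntervals _ _ _).imp fun h => Or.inl h,
    (pairwise_lobeIntervals _ _ _).imp fun h => Or.inr ?_, ?_⟩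
  · simp only; omega
  · intro x hx y hy
    rw [List.mem_map] at hy
    obtain ⟨z, hz, rfl⟩ := hy
    have h1 := lobeIntervals_bounds hx
    have h2 := lobeIntervals_bounds hz
    left
    simp only
    omega

theorem image_sub_Ico (c p q : ℤ) :
    (Finset.Ico p q).image (fun x => c - x) = Finset.Ico (c + 1 - q) (c + 1 - p) := by
  ext x
  simp only [Finset.mem_image, Finset.mem_Ico]
  exact ⟨fun ⟨y, hy, e⟩ => by omega, fun hx => ⟨c - x, by omega, by ring⟩⟩

/-- The rotation exchanges up-pointing and down-pointing lobes of the pair, so the mirror image of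
the up positions is the set of down positions. -/
theorem upPositions_union_image (m : ℤ) (a : List ℕ) :
    upPositions m a ∪ (upPositions m a).image (fun p => 2 * m + 2 * a.sum - p) =
      fernPositions m a.sum := by
  have h1 := lobePositions_union_not m true a
  have h2 : Finset.Ico (m + a.sum + 1) (m + 2 * a.sum + 1) =
      (Finset.Ico m (m + a.sum)).image fun p => 2 * m + 2 * a.sum - p := by
    rw [image_sub_Ico]
    congr 1 <;> omega
  rw [fernPositions, h2, ← h1, upPositions, Finset.image_union, Finset.image_union,
    image_sub_image_sub]
  ext x
  simp only [Finset.mem_union, Bool.not_true]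
  tauto

theorem disjoint_upPositions_image (m : ℤ) (a : List ℕ) :
    Disjoint (upPositions m a) ((upPositions m a).image fun p => 2 * m + 2 * a.sum - p) := by
  have h1 := disjoint_lobePositions_not m true a
  rw [Finset.disjoint_left] at h1 ⊢
  intro x hx hx'
  rw [upPositions, Finset.image_union, image_sub_image_sub, Finset.mem_union] at hx'
  rw [upPositions, Finset.mem_union] at hx
  rcases hx with hx | hx
  · rcases hx' with hx' | hx'
    · obtain ⟨y, hy, rfl⟩ := Finset.mem_image.1 hx'
      have b1 := lobePositions_subset _ _ _ hx
      have b2 := lobePositions_subset _ _ _ hy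
      rw [Finset.mem_Ico] at b1 b2
      omega
    · exact h1 hx hx'
  · obtain ⟨y, hy, rfl⟩ := Finset.mem_image.1 hx
    rcases hx' with hx' | hx'
    · obtain ⟨z, hz, e⟩ := Finset.mem_image.1 hx'
      have : z = y := by omega
      exact h1 (this ▸ hz) hy
    · have b1 := lobePositions_subset _ _ _ hx'
      have b2 := lobePositions_subset _ _ _ hy
      rw [Finset.mem_Ico] at b1 b2
      omega

theorem card_upPositions (m : ℤ) (a : List ℕ) : (upPositions m a).card = a.sum := by
  have h1 := card_lobePositions_add_not m true a
  rw [upPositions, Finset.card_union_of_disjoint, Finset.card_image_of_injective]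
  · exact h1
  · exact fun x y h => by simpa using h
  · rw [Finset.disjoint_left]
    intro x hx hx'
    obtain ⟨y, hy, rfl⟩ := Finset.mem_image.1 hx'
    have b1 := lobePositions_subset _ _ _ hx
    have b2 := lobePositions_subset _ _ _ hy
    rw [Finset.mem_Ico] at b1 b2
    omega

theorem upPositions_subset (m : ℤ) (a : List ℕ) : upPositions m a ⊆ fernPositions m a.sum :=
  upPositions_union_image m a ▸ Finset.subset_union_left

/-! ### The upper half of the region as a dented trapezoid -/

/-- The left endpoint of the segment by which the base of the trapezoid extends the axis of the
hexagon. -/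
def extStart (m h : ℤ) (s : ℕ) : ℤ :=
  if 0 ≤ h then 2 * m + 2 * s + 1 else 0

/-- The positions in the base of the trapezoid outside the hexagon. -/
noncomputable def extPositions (m h : ℤ) (s : ℕ) : Finset ℤ :=
  Finset.Ico (extStart m h s) (extStart m h s + h.natAbs)

/-- The positions along the axis of the hexagon that are not covered by the ferns. -/
noncomputable def freePositions (m h : ℤ) (s : ℕ) : Finset ℤ :=
  Finset.Ico (max 0 (-h)) (2 * m + 2 * s + 1 + min 0 h) \ fernPositions m s

section geometry
variable {m h y : ℤ} {a : List ℕ} {n : ℕ}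

/-- The base point of the left fern is `(m, h)` and twice the centre is `(2m + 2s + 1, 2h)` with `s
= a.sum`. The down-pointing lobes of the pair are the rotated up-pointing ones, so `upIntervals`
describes all removed triangles. -/
theorem mem_fcRegion {t : UnitTriangle} :
    t ∈ fcRegion (2 * m - y) y (y + 2 * h) a ↔
      t ∈ hexagon (2 * m - y + a.sum + 1) (y + a.sum) (y + 2 * h + a.sum) ∧
      (∀ x ∈ upIntervals m a, t ∉ bigTriangle (x.1, h) x.2 true) ∧
      (∀ x ∈ upIntervals m a,
        t ∉ bigTriangle (2 * m + 2 * a.sum + 1 - x.1 - x.2, h) x.2 false) := by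
  have hc : fcCenter (2 * m - y) y (y + 2 * h) a = (2 * m + 2 * a.sum + 1, 2 * h) := by
    simp only [fcCenter, twiceCenter]
    refine Prod.ext ?_ ?_ <;> simp only <;> ring
  have hb : ((twiceCenter (2 * m - y) y (y + 2 * h)).1 / 2,
      (twiceCenter (2 * m - y) y (y + 2 * h)).2 / 2) = (m, h) := by
    simp only [twiceCenter]
    ext <;> simp [-Nat.cast_list_sum, -Nat.cast_natAbs]
  have himg : ∀ S : Set UnitTriangle,
      t ∈ UnitTriangle.rotate (2 * m + 2 * a.sum + 1, 2 * h) '' S ↔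
        t.rotate (2 * m + 2 * a.sum + 1, 2 * h) ∈ S := by
    intro S
    constructor
    · rintro ⟨u, hu, rfl⟩
      rwa [rotate_rotate]
    · exact fun hu => ⟨_, hu, rotate_rotate _ _⟩
  rw [fcRegion, Set.mem_sdiff, Set.mem_union, hc, himg, leftFern, hb, fern, mem_lobes, mem_lobes]
  simp only [rotate_mem_bigTriangle (c := (2 * m + 2 * a.sum + 1, 2 * h)) rfl, upIntervals,
    List.mem_append, List.mem_map, Bool.not_true, Bool.not_false]
  refine and_congr_right fun _ => ?_
  constructor
  · intro hn
    push Not at hn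
    refine ⟨?_, ?_⟩
    · rintro x (hx | ⟨z, hz, rfl⟩)
      · exact hn.1.1 x hx
      · exact hn.2.2 z hz
    · rintro x (hx | ⟨z, hz, rfl⟩)
      · exact hn.2.1 x hx
      · have := hn.1.2 z hz
        convert this using 3
        exact Prod.ext (by simp only; ring) rfl
  · rintro ⟨h1, h2⟩ ((⟨x, hx, hx'⟩ | ⟨x, hx, hx'⟩) | (⟨x, hx, hx'⟩ | ⟨x, hx, hx'⟩))
    · exact h1 x (Or.inl hx) hx'
    · refine h2 _ (Or.inr ⟨x, hx, rfl⟩) ?_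
      convert hx' using 3
      ring
    · exact h2 x (Or.inl hx) hx'
    · exact h1 _ (Or.inr ⟨x, hx, rfl⟩) hx'

/-- For `h ≥ 0` the eastern corner lies at height `2h`, on or above the axis, and the missing
triangle is to the right; for `h < 0` the western corner, at height `0`, lies above the axis and it
is to the left. -/
theorem mem_hexagon_upper {t : UnitTriangle} (s : ℕ)
    (hn : (n : ℤ) = y + h + s) (ht : h ≤ t.j) :
    t ∈ hexagon (2 * m - y + s + 1) (y + s) (y + 2 * h + s) ↔
      t ∈ trapezoid h n (2 * m + h + 2 * s + 1) ∧
        t ∉ bigTriangle (extStart m h s, h) h.natAbs true := by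
  obtain ⟨i, j, u⟩ := t
  simp only at ht
  rw [mem_bigTriangle_up, extStart]
  cases u <;> simp [-Nat.cast_list_sum, -Nat.cast_natAbs, hexagon, trapezoid] <;> split_ifs <;> omega

theorem upperPart_fcRegion (hn : (n : ℤ) = y + h + a.sum)
    (X : Finset ℤ) :
    upperPart (fcRegion (2 * m - y) y (y + 2 * h) a) h X =
      (trapezoid h n (2 * m + h + 2 * a.sum + 1) \ baseUps h X) \
        {t | ∃ x ∈ (extStart m h a.sum, h.natAbs) :: upIntervals m a,
          t ∈ bigTriangle (x.1, h) x.2 true} := by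
  ext t
  rw [upperPart, Set.mem_sdiff, Set.mem_sdiff, Set.mem_sdiff]
  simp only [Set.mem_ofPred_eq, List.mem_cons, exists_eq_or_imp, mem_fcRegion]
  constructor
  · rintro ⟨⟨⟨h1, h2, h3⟩, h4⟩, h5⟩
    rw [mem_hexagon_upper a.sum hn h4] at h1
    refine ⟨⟨h1.1, h5⟩, ?_⟩
    rintro (h6 | ⟨x, hx, hx'⟩)
    · exact h1.2 h6
    · exact h2 x hx hx'
  · rintro ⟨⟨h1, h5⟩, h2⟩
    push Not at h2
    have h4 : h ≤ t.j := h1.2.1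
    refine ⟨⟨⟨(mem_hexagon_upper a.sum hn h4).2 ⟨h1, h2.1⟩, h2.2, ?_⟩, h4⟩, h5⟩
    intro x _ hx
    exact absurd (lt_of_mem_bigTriangle_down hx) (not_lt.2 h4)

/-- A lozenge can cross at `p` only if neither an up-pointing nor a down-pointing lobe covers `p`;
the latter means that the mirror image of `p` is not an up position. For `n = 0` the hexagon
degenerates to a segment and no lozenge crosses it. -/
theorem mem_freePositions_iff (hy : 0 ≤ y) (hz : 0 ≤ y + 2 * h)
    (hn : (n : ℤ) = y + h + a.sum) (hpos : 0 < n) (p : ℤ) :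
    p ∈ freePositions m h a.sum ↔
      (⟨p, h, true⟩ : UnitTriangle) ∈ fcRegion (2 * m - y) y (y + 2 * h) a ∧
      (⟨p, h - 1, false⟩ : UnitTriangle) ∈ fcRegion (2 * m - y) y (y + 2 * h) a := by
  have hF : p ∉ fernPositions m a.sum ↔ p ∉ upPositions m a ∧
      2 * m + 2 * a.sum - p ∉ upPositions m a := by
    rw [← upPositions_union_image m a, Finset.mem_union, not_or, Finset.mem_image]
    refine and_congr_right fun _ => not_congr ⟨?_, fun hp => ⟨_, hp, by ring⟩⟩
    rintro ⟨q, hq, rfl⟩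
    simpa using hq
  rw [freePositions, Finset.mem_sdiff, hF, mem_fcRegion, mem_fcRegion, mem_upPositions,
    mem_upPositions]
  push Not
  simp only [mem_bigTriangle_up, mem_bigTriangle_down, Finset.mem_Ico, hexagon, mem_trianglesIn_up,
    mem_trianglesIn_down, Set.mem_ofPred_eq]
  constructor
  · rintro ⟨h1, h2, h3⟩
    refine ⟨⟨by omega, fun x hx hc => ?_, fun x hx hc => by omega⟩,
      ⟨by omega, fun x hx hc => by omega, fun x hx hc => ?_⟩⟩
    · have := h2 x hx
      simp [-Nat.cast_list_sum, -Nat.cast_natAbs] at hc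
      omega
    · have := h3 x hx
      simp [-Nat.cast_list_sum, -Nat.cast_natAbs] at hc
      omega
  · rintro ⟨⟨h1, h2, -⟩, ⟨h4, -, h5⟩⟩
    refine ⟨by omega, fun x hx hc => ?_, fun x hx hc => ?_⟩
    · by_contra hlt
      exact h2 x hx ⟨hc, le_rfl, by simp [-Nat.cast_list_sum, -Nat.cast_natAbs]; omega⟩
    · by_contra hlt
      exact h5 x hx ⟨by omega, by omega, by simp [-Nat.cast_list_sum, -Nat.cast_natAbs]; omega⟩

theorem mem_fernPositions {p : ℤ} {s : ℕ} :
    p ∈ fernPositions m s ↔ (m ≤ p ∧ p < m + s) ∨ (m + s + 1 ≤ p ∧ p < m + 2 * s + 1) := by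
  rw [fernPositions, Finset.mem_union, Finset.mem_Ico, Finset.mem_Ico]

theorem mem_freePositions {p : ℤ} {s : ℕ} :
    p ∈ freePositions m h s ↔ (max 0 (-h) ≤ p ∧ p < 2 * m + 2 * s + 1 + min 0 h) ∧
      ¬ ((m ≤ p ∧ p < m + s) ∨ (m + s + 1 ≤ p ∧ p < m + 2 * s + 1)) := by
  rw [freePositions, Finset.mem_sdiff, Finset.mem_Ico, mem_fernPositions]

theorem mem_extPositions {p : ℤ} {s : ℕ} :
    p ∈ extPositions m h s ↔
      (0 ≤ h ∧ 2 * m + 2 * s + 1 ≤ p ∧ p < 2 * m + 2 * s + 1 + h) ∨ (h < 0 ∧ 0 ≤ p ∧ p < -h) := by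
  rw [extPositions, Finset.mem_Ico, extStart]
  split_ifs <;> omega

theorem disjoint_free_ext (s : ℕ) : Disjoint (freePositions m h s) (extPositions m h s) := by
  rw [Finset.disjoint_left]
  intro p h1 h2
  rw [mem_freePositions] at h1
  rw [mem_extPositions] at h2
  omega

theorem disjoint_ext_fern (hm : 0 ≤ m) (hmh : 0 ≤ m + h) (s : ℕ) :
    Disjoint (extPositions m h s) (fernPositions m s) := by
  rw [Finset.disjoint_left]
  intro p h1 h2
  rw [mem_fernPositions] at h2
  rw [mem_extPositions] at h1
  omega

theorem disjoint_free_fern (s : ℕ) : Disjoint (freePositions m h s) (fernPositions m s) :=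
  Finset.sdiff_disjoint

theorem card_extPositions (s : ℕ) : (extPositions m h s).card = h.natAbs := by
  rw [extPositions, Int.card_Ico]
  omega

theorem dents_subset (hm : 0 ≤ m) (hmh : 0 ≤ m + h) {s : ℕ} {M : ℕ}
    (hM : (M : ℤ) = 2 * m + h + 2 * s + 1) :
    freePositions m h s ∪ extPositions m h s ∪ fernPositions m s ⊆ Finset.Ico 0 (M : ℤ) := by
  intro p hp
  rw [Finset.mem_union, Finset.mem_union, mem_freePositions, mem_extPositions,
    mem_fernPositions] at hp
  rw [Finset.mem_Ico]
  omega

theorem numTilings_upperPart_fcRegion (hm : 0 ≤ m) (hmh : 0 ≤ m + h) (hy : 0 ≤ y)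
    (hz : 0 ≤ y + 2 * h) (hn : (n : ℤ) = y + h + a.sum) {X : Finset ℤ}
    (hX : X ⊆ freePositions m h a.sum) :
    numTilings (upperPart (fcRegion (2 * m - y) y (y + 2 * h) a) h X) =
      numTilings (trapezoid h n (2 * m + h + 2 * a.sum + 1) \
        baseUps h (X ∪ extPositions m h a.sum ∪ upPositions m a : Finset ℤ)) := by
  rw [upperPart_fcRegion hn, numTilings_diff_bigTriangles]
  · congr 1
    ext t
    simp only [Set.mem_sdiff, baseUps, Set.mem_ofPred_eq, Finset.mem_coe, Finset.mem_union,
      mem_upPositions, List.mem_cons, exists_eq_or_imp, extPositions, Finset.mem_Ico]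
    generalize (∃ x ∈ upIntervals m a, x.1 ≤ t.i ∧ t.i < x.1 + x.2) = P
    tauto
  · exact (trapezoid_finite _ _ _).subset Set.sdiff_subset
  · rintro x hx ⟨i, j, u⟩ ht
    rw [mem_bigTriangle_up] at ht
    have hb : 0 ≤ x.1 ∧ x.1 + x.2 ≤ 2 * m + h + 2 * a.sum + 1 ∧ x.2 ≤ n := by
      rw [List.mem_cons] at hx
      rcases hx with rfl | hx
      · simp only [extStart]
        split_ifs <;> omega
      · have := upIntervals_bounds hx
        omega
    refine ⟨?_, ?_⟩
    · cases u <;> simp [-Nat.cast_list_sum, -Nat.cast_natAbs, trapezoid] at ht ⊢ <;> omega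
    · rintro ⟨hu, hj, hi⟩
      simp only at hu hj hi
      subst hu hj
      have hfree := hX hi
      simp [-Nat.cast_list_sum, -Nat.cast_natAbs] at ht
      rw [List.mem_cons] at hx
      rcases hx with rfl | hx
      · refine Finset.disjoint_left.1 (disjoint_free_ext a.sum) hfree ?_
        rw [extPositions, Finset.mem_Ico]
        simp only at ht
        omega
      · refine Finset.disjoint_left.1 (disjoint_free_fern a.sum) hfree (upPositions_subset m a ?_)
        rw [mem_upPositions]
        exact ⟨x, hx, by omega⟩
  · rw [List.pairwise_cons]
    constructor
    · intro x hx
      have hb := upIntervals_bounds hx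
      by_cases hh : 0 ≤ h
      · refine (disjoint_bigTriangle ?_).symm
        simp only [extStart, if_pos hh]
        omega
      · refine disjoint_bigTriangle ?_
        simp only [extStart, if_neg hh]
        omega
    · refine (pairwise_upIntervals m a).imp fun {x z} hxz => ?_
      rcases hxz with hxz | hxz
      · exact disjoint_bigTriangle hxz
      · exact (disjoint_bigTriangle hxz).symm

/-! ### Factorization of the symmetric count -/

/-- The possible sets of positions of the lozenges crossing the axis. -/
noncomputable def crossingSets (m h : ℤ) (s n : ℕ) : Finset (Finset ℤ) :=
  {X ∈ (freePositions m h s).powerset |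
    (∀ p ∈ X, 2 * m + 2 * s - p ∈ X) ∧ X.card + h.natAbs + s = n}

/-- The common factor of the counts of all pairs of ferns with a given total size. -/
noncomputable def crossingWeight (m h : ℤ) (s n : ℕ) : ℕ :=
  ∑ X ∈ crossingSets m h s n, vand (X ∪ extPositions m h s) * crossDist X (upPositions m [s])

theorem card_dents {s : ℕ} (hm : 0 ≤ m) (hmh : 0 ≤ m + h) (hs : a.sum = s) {X : Finset ℤ}
    (hX : X ⊆ freePositions m h s) :
    Disjoint X (extPositions m h s) ∧ Disjoint (X ∪ extPositions m h s) (upPositions m a) ∧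
      (X ∪ extPositions m h s ∪ upPositions m a).card = X.card + h.natAbs + s := by
  subst hs
  have h1 : Disjoint X (extPositions m h a.sum) := (disjoint_free_ext a.sum).mono_left hX
  have h2 : Disjoint (X ∪ extPositions m h a.sum) (upPositions m a) := by
    rw [Finset.disjoint_union_left]
    exact ⟨(disjoint_free_fern a.sum).mono hX (upPositions_subset m a),
      (disjoint_ext_fern hm hmh a.sum).mono_right (upPositions_subset m a)⟩
  refine ⟨h1, h2, ?_⟩
  rw [Finset.card_union_of_disjoint h2, Finset.card_union_of_disjoint h1, card_extPositions,
    card_upPositions]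

theorem rotate_mem_fcRegion {t : UnitTriangle} (ht : t ∈ fcRegion (2 * m - y) y (y + 2 * h) a) :
    t.rotate (2 * m + 2 * a.sum + 1, 2 * h) ∈ fcRegion (2 * m - y) y (y + 2 * h) a := by
  rw [mem_fcRegion] at ht ⊢
  refine ⟨?_, fun x hx hc => ?_, fun x hx hc => ?_⟩
  · obtain ⟨i, j, u⟩ := t
    have := ht.1
    cases u <;> simp [-Nat.cast_list_sum, -Nat.cast_natAbs, hexagon, UnitTriangle.rotate] at this ⊢ <;> omega
  · rw [rotate_mem_bigTriangle (c := (2 * m + 2 * a.sum + 1, 2 * h)) rfl] at hc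
    exact ht.2.2 x hx hc
  · rw [rotate_mem_bigTriangle (c := (2 * m + 2 * a.sum + 1, 2 * h)) rfl] at hc
    refine ht.2.1 x hx ?_
    convert hc using 3
    · simp only
      ring
    · rfl

theorem fcRegion_finite : (fcRegion (2 * m - y) y (y + 2 * h) a).Finite := by
  have : (Set.range fun x : (Finset.Icc (0 : ℤ) (2 * m + 2 * a.sum + 1)) ×
      (Finset.Icc (-(y + a.sum)) (y + 2 * h + a.sum)) × Bool =>
      (⟨x.1, x.2.1, x.2.2⟩ : UnitTriangle)).Finite := Set.finite_range _
  refine this.subset ?_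
  rintro ⟨i, j, u⟩ ht
  have ht' := (mem_fcRegion.1 ht).1
  refine ⟨⟨⟨i, ?_⟩, ⟨j, ?_⟩, u⟩, rfl⟩ <;> rw [Finset.mem_Icc] <;>
    cases u <;> simp [-Nat.cast_list_sum, -Nat.cast_natAbs, hexagon] at ht' <;> omega

/-- The factor `crossingWeight` depends on the list only through its sum. Comparing `a` with
`[a.sum]` therefore leaves only the internal differences of the up positions and their distances to
the extension. -/
theorem fcCount_mul_hyperfact (hx : -1 ≤ 2 * m - y) (hy : 0 ≤ y) (hz : 0 ≤ y + 2 * h)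
    (hn : (n : ℤ) = y + h + a.sum) :
    fcCount (2 * m - y) y (y + 2 * h) a * hyperfact n =
      vand (upPositions m a) * crossDist (extPositions m h a.sum) (upPositions m a) *
        crossingWeight m h a.sum n := by
  have hm : 0 ≤ m := by omega
  have hmh : 0 ≤ m + h := by omega
  obtain ⟨M, hM⟩ : ∃ M : ℕ, (M : ℤ) = 2 * m + h + 2 * a.sum + 1 :=
    ⟨(2 * m + h + 2 * a.sum + 1).toNat, by omega⟩
  have hc : fcCenter (2 * m - y) y (y + 2 * h) a = (2 * m + 2 * a.sum + 1, 2 * h) := by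
    simp only [fcCenter, twiceCenter]
    refine Prod.ext ?_ ?_ <;> simp only <;> ring
  have hsub : ∀ X ⊆ freePositions m h a.sum,
      X ∪ extPositions m h a.sum ∪ upPositions m a ⊆ Finset.Ico 0 (M : ℤ) := fun X hX =>
    (Finset.union_subset_union (Finset.union_subset_union hX le_rfl)
      (upPositions_subset m a)).trans (dents_subset hm hmh hM)
  have hmain : fcCount (2 * m - y) y (y + 2 * h) a =
      ∑ X ∈ crossingSets m h a.sum n, numTilings (trapezoid h n M \
        baseUps h (X ∪ extPositions m h a.sum ∪ upPositions m a : Finset ℤ)) := by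
    -- For `n = 0` all of `y`, `h` and `a.sum` vanish and the region is empty; only the empty
    -- crossing set is possible.
    rcases Nat.eq_zero_or_pos n with h0 | hpos
    · have hy0 : y = 0 := by omega
      have hh0 : h = 0 := by omega
      have hs0 : a.sum = 0 := by omega
      have hcs : crossingSets m h a.sum n = {∅} := by
        ext X
        simp only [crossingSets, Finset.mem_filter, Finset.mem_singleton, Finset.mem_powerset]
        constructor
        · rintro ⟨_, _, hcard⟩
          exact Finset.card_eq_zero.1 (by omega)
        · rintro rfl
          simp [-Nat.cast_list_sum, -Nat.cast_natAbs, h0, hh0, hs0]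
      rw [hcs, Finset.sum_singleton, fcCount, hc, numSymmTilings_eq_sum (h := h) rfl fcRegion_finite
        (fun t ht => rotate_mem_fcRegion ht) ∅]
      · rw [Finset.powerset_empty, Finset.filter_singleton, if_pos (by simp [-Nat.cast_list_sum, -Nat.cast_natAbs]), Finset.sum_singleton,
          numTilings_upperPart_fcRegion hm hmh hy hz hn (by simp [-Nat.cast_list_sum, -Nat.cast_natAbs]), hM]
      · intro p
        simp only [Finset.notMem_empty, false_iff, not_and]
        intro hp
        have := (mem_fcRegion.1 hp).1
        simp [-Nat.cast_list_sum, -Nat.cast_natAbs, hexagon] at this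
        omega
    · rw [fcCount, hc, numSymmTilings_eq_sum (h := h) rfl fcRegion_finite
        (fun t ht => rotate_mem_fcRegion ht) (freePositions m h a.sum)
        (mem_freePositions_iff hy hz hn hpos)]
      symm
      -- Crossing sets giving a number of dents different from `n` contribute no tilings.
      apply Finset.sum_subset_zero_on_sdiff
      · intro X hX
        rw [crossingSets, Finset.mem_filter] at hX
        rw [Finset.mem_filter]
        refine ⟨hX.1, fun p hp => ?_⟩
        have := hX.2.1 p hp
        convert this using 1
        simp [-Nat.cast_list_sum, -Nat.cast_natAbs]
      · intro X hX
        rw [Finset.mem_sdiff, Finset.mem_filter, crossingSets, Finset.mem_filter] at hX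
        have hXf := Finset.mem_powerset.1 hX.1.1
        rw [numTilings_upperPart_fcRegion hm hmh hy hz hn hXf, ← hM]
        refine numTilings_trapezoid_eq_zero h (by omega) (hsub X hXf) hpos ?_
        rw [(card_dents hm hmh rfl hXf).2.2]
        intro hcard
        refine hX.2 ⟨hX.1.1, fun p hp => ?_, hcard⟩
        have := hX.1.2 p hp
        convert this using 1
        simp [-Nat.cast_list_sum, -Nat.cast_natAbs]
      · intro X hX
        rw [crossingSets, Finset.mem_filter, Finset.mem_powerset] at hX
        rw [numTilings_upperPart_fcRegion hm hmh hy hz hn hX.1, hM]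
  rw [hmain, Finset.sum_mul, crossingWeight, Finset.mul_sum]
  refine Finset.sum_congr rfl fun X hX => ?_
  rw [crossingSets, Finset.mem_filter, Finset.mem_powerset] at hX
  obtain ⟨d1, d2, hcard⟩ := card_dents (a := a) hm hmh rfl hX.1
  have hsum : [a.sum].sum = a.sum := by simp [-Nat.cast_list_sum, -Nat.cast_natAbs]
  have hU := disjoint_upPositions_image m [a.sum]
  have hUF := upPositions_union_image m [a.sum]
  rw [hsum] at hU hUF
  -- The distances from `X` to the up positions are replaced by those for a single pair of lobes of
  -- size `a.sum`.
  rw [numTilings_trapezoid_mul_hyperfact h (hsub X hX.1) (hcard.trans hX.2.2), vand_union d2,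
    crossDist_union_left d1, crossDist_eq_of_symm hX.2.1 (disjoint_upPositions_image m a)
      (upPositions_union_image m a) hU hUF]
  ring

/-- All summands are nonnegative, so one admissible crossing set suffices. It must have `n - |h| - s
= min y (y + 2h)` elements. -/
theorem crossingWeight_pos {s : ℕ} (hx : -1 ≤ 2 * m - y) (hy : 0 ≤ y) (hz : 0 ≤ y + 2 * h)
    (hn : (n : ℤ) = y + h + s) : 0 < crossingWeight m h s n := by
  obtain ⟨q, r, hqr, hr⟩ : ∃ q r : ℕ, ((2 * q + r : ℕ) : ℤ) = min y (y + 2 * h) ∧ r < 2 :=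
    ⟨(min y (y + 2 * h)).toNat / 2, (min y (y + 2 * h)).toNat % 2, by omega, by omega⟩
  -- The set consists of the `q` leftmost positions on the axis, their mirror images and, if the
  -- required size is odd, the central position `m + s`. The bound `-1 ≤ 2 * m - y` ensures that the
  -- `q` positions fit to the left of the ferns.
  set L := Finset.Ico (max 0 (-h)) (max 0 (-h) + q)
  set C := Finset.Ico (m + s) (m + s + r)
  have hd1 : Disjoint L (L.image fun p => 2 * m + 2 * s - p) := by
    rw [image_sub_Ico, Finset.disjoint_left]
    intro p hp hp'
    rw [Finset.mem_Ico] at hp hp'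
    omega
  have hd2 : Disjoint (L ∪ L.image fun p => 2 * m + 2 * s - p) C := by
    rw [image_sub_Ico, Finset.disjoint_left]
    intro p hp hp'
    rw [Finset.mem_union, Finset.mem_Ico, Finset.mem_Ico] at hp
    rw [Finset.mem_Ico] at hp'
    omega
  have hmem : L ∪ (L.image fun p => 2 * m + 2 * s - p) ∪ C ∈ crossingSets m h s n := by
    rw [crossingSets, Finset.mem_filter, Finset.mem_powerset]
    refine ⟨?_, ?_, ?_⟩
    · intro p hp
      rw [image_sub_Ico, Finset.mem_union, Finset.mem_union, Finset.mem_Ico, Finset.mem_Ico,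
        Finset.mem_Ico] at hp
      rw [mem_freePositions]
      omega
    · intro p hp
      rw [image_sub_Ico, Finset.mem_union, Finset.mem_union, Finset.mem_Ico, Finset.mem_Ico,
        Finset.mem_Ico] at hp ⊢
      omega
    · rw [Finset.card_union_of_disjoint hd2, Finset.card_union_of_disjoint hd1,
        Finset.card_image_of_injective _ (fun x y h => by simpa using h)]
      simp only [L, C, Int.card_Ico]
      omega
  refine lt_of_lt_of_le (Nat.mul_pos (vand_pos _) (crossDist_pos ?_))
    (Finset.single_le_sum (f := fun X => vand (X ∪ extPositions m h s) *
      crossDist X (upPositions m [s])) (fun _ _ => Nat.zero_le _) hmem)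
  rw [crossingSets, Finset.mem_filter, Finset.mem_powerset] at hmem
  have := upPositions_subset m [s]
  rw [List.sum_singleton] at this
  exact (disjoint_free_fern s).mono hmem.1 this

end geometry

/-! ### The lists with the central gap inserted -/

theorem modify_append_length_add (l l' : List ℕ) (i : ℕ) (f : ℕ → ℕ) :
    (l ++ l').modify (l.length + i) f = l ++ l'.modify i f := by
  induction l with
  | nil => simp
  | cons n l ih => simp [Nat.add_right_comm, ih]

theorem doubled_concat (l : List ℕ) (n : ℕ) : doubled (l ++ [n]) = l ++ n :: n :: l.reverse := by
  simp [doubled]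

theorem semihexagonArgs_concat (l : List ℕ) (n : ℕ) :
    semihexagonArgs (l ++ [n]) = l ++ (n + 1) :: n :: l.reverse := by
  have h : (l ++ [n]).length - 1 = l.length + 0 := by simp
  rw [semihexagonArgs, doubled_concat, h, modify_append_length_add]
  simp

theorem gappedLobes_concat (l : List ℕ) (n : ℕ) :
    gappedLobes (l ++ [n]) =
      if l.length.bodd then l ++ (n + 1) :: n :: l.reverse else l ++ n :: (n + 1) :: l.reverse := by
  have h : Odd (l ++ [n]).length ↔ l.length.bodd = false := by
    rw [List.length_append, List.length_singleton, Nat.odd_add_one, Nat.not_odd_iff_even,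
      Nat.even_iff, Nat.mod_two_of_bodd]
    cases l.length.bodd <;> simp
  rw [gappedLobes, doubled_concat]
  cases hb : l.length.bodd
  · rw [if_pos (h.2 hb), if_neg (by simp), List.length_append, List.length_singleton,
      modify_append_length_add]
    simp
  · have h1 : (l ++ [n]).length - 1 = l.length + 0 := by simp
    rw [if_neg (by rw [h, hb]; simp), if_pos rfl, h1, modify_append_length_add]
    simp

theorem length_gappedLobes (a : List ℕ) : (gappedLobes a).length = 2 * a.length := by
  simp [gappedLobes, doubled]
  ring

theorem sum_gappedLobes {a : List ℕ} (ha : a ≠ []) : (gappedLobes a).sum = 2 * a.sum + 1 := by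
  obtain ⟨l, n, rfl⟩ := (List.eq_nil_or_concat' a).resolve_left ha
  rw [gappedLobes_concat]
  split_ifs <;> simp <;> ring

theorem upPositions_concat (m : ℤ) (l : List ℕ) (n : ℕ) :
    upPositions m (l ++ [n]) = lobePositions m true l ∪
      ((if l.length.bodd then ∅ else Finset.Ico (m + l.sum) (m + l.sum + n)) ∪
        lobePositions (m + l.sum + n + 1) l.length.bodd (n :: l.reverse)) := by
  rw [upPositions, image_sub_lobePositions, lobePositions_append, Finset.union_assoc]
  congr 2
  · cases l.length.bodd <;> simp [lobePositions]
  · congr 1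
    · simp only [List.sum_append, List.sum_singleton, Nat.cast_add]
      ring
    · simp
    · simp

/-- The choice by parity in `gappedLobes` always adds the unit gap to the down-pointing one of the
two middle lobes, so the up positions are unchanged. -/
theorem lobePositions_gappedLobes (m : ℤ) {a : List ℕ} (ha : a ≠ []) :
    lobePositions m true (gappedLobes a) = upPositions m a := by
  obtain ⟨l, n, rfl⟩ := (List.eq_nil_or_concat' a).resolve_left ha
  rw [upPositions_concat, gappedLobes_concat]
  cases hb : l.length.bodd
  · rw [if_neg (by simp), if_neg (by simp), lobePositions_append, hb, lobePositions, lobePositions,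
      lobePositions]
    simp [add_assoc, add_comm, add_left_comm]
  · rw [if_pos rfl, if_pos rfl, lobePositions_append, hb, lobePositions]
    simp [add_assoc]

/-- Here the gap always goes to the `k`-th lobe, with `k` the length of `a`: this points down for
even `k`, and points up for odd `k`, in which case the central position is gained. -/
theorem lobePositions_semihexagonArgs (m : ℤ) {a : List ℕ} (ha : a ≠ []) :
    lobePositions m true (semihexagonArgs a) = upPositions m a ∨
      lobePositions m true (semihexagonArgs a) = upPositions m a ∪ {m + (a.sum : ℤ)} := by
  obtain ⟨l, n, rfl⟩ := (List.eq_nil_or_concat' a).resolve_left ha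
  rw [upPositions_concat, semihexagonArgs_concat]
  cases hb : l.length.bodd
  · right
    rw [if_neg (by simp), lobePositions_append, hb, lobePositions, lobePositions,
      lobePositions]
    have h1 : Finset.Ico (m + l.sum) (m + l.sum + (n + 1 : ℕ)) =
        Finset.Ico (m + l.sum) (m + l.sum + n) ∪ {m + ((l ++ [n]).sum : ℤ)} := by
      rw [Ico_add_succ, Finset.insert_eq, Finset.union_comm]
      simp [add_assoc]
    have h2 : m + l.sum + (n + 1 : ℕ) + n = m + l.sum + n + 1 + n := by push_cast; ring
    simp only [Bool.bne_false, Bool.not_true, if_true, Bool.false_eq_true, if_false,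
      Finset.empty_union, Bool.not_false, h1, h2]
    ext x
    simp only [Finset.mem_union]
    tauto
  · left
    rw [if_pos rfl, lobePositions_append, hb, lobePositions]
    simp [add_assoc]

theorem upPositions_singleton (m : ℤ) (s : ℕ) : upPositions m [s] = Finset.Ico m (m + s) := by
  simp [upPositions, lobePositions]

/-! ### The semihexagon count -/

theorem semihexagon_eq (b : List ℕ) :
    semihexagon b = trapezoid 0 (oddSum b) b.sum \ baseUps 0 (lobePositions 0 true b) := by
  rw [semihexagon, baseTriangles_eq]
  congr 1
  ext ⟨i, j, u⟩
  cases u <;> simp [trapezoid, -Nat.cast_list_sum] <;> omega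

theorem semihexagonCount_mul_hyperfact (b : List ℕ) :
    semihexagonCount b * hyperfact (oddSum b) = vand (lobePositions 0 true b) := by
  rw [semihexagonCount, semihexagon_eq]
  refine numTilings_trapezoid_mul_hyperfact 0 ?_ (oddSum_eq_card 0 b).symm
  simpa [-Nat.cast_list_sum] using lobePositions_subset 0 true b

/-- If the central position is an extra dent, it contributes its distances to the up positions. By
symmetry these multiply to the same value as for a single lobe, which is exactly the quotient of
`hyperfact (a.sum + 1)` by `hyperfact a.sum`. -/
theorem vand_upPositions (m : ℤ) {a : List ℕ} (ha : a ≠ []) :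
    semihexagonCount (semihexagonArgs a) * hyperfact a.sum = vand (upPositions m a) := by
  have key := semihexagonCount_mul_hyperfact (semihexagonArgs a)
  have himg := image_add_lobePositions 0 m true (semihexagonArgs a)
  rw [zero_add] at himg
  rw [← vand_image_add m, himg, oddSum_eq_card m] at key
  rcases lobePositions_semihexagonArgs m ha with h | h
  · rwa [h, card_upPositions] at key
  · have hnot : m + (a.sum : ℤ) ∉ fernPositions m a.sum := by
      rw [mem_fernPositions]; omega
    have hd : Disjoint (upPositions m a) {m + (a.sum : ℤ)} := by
      rw [Finset.disjoint_singleton_right]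
      exact fun h => hnot (upPositions_subset m a h)
    have hU := disjoint_upPositions_image m [a.sum]
    have hUF := upPositions_union_image m [a.sum]
    rw [List.sum_singleton] at hU hUF
    have hsymm : crossDist {m + (a.sum : ℤ)} (upPositions m a) =
        crossDist {m + (a.sum : ℤ)} (upPositions m [a.sum]) :=
      crossDist_eq_of_symm (c := 2 * m + 2 * a.sum) (by simp only [Finset.mem_singleton]; omega)
        (disjoint_upPositions_image m a) (upPositions_union_image m a) hU hUF
    have hd0 : Disjoint (Finset.Ico m (m + (a.sum : ℤ))) {m + (a.sum : ℤ)} := by simp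
    -- An interval of length `a.sum + 1` is the single lobe together with the central position.
    have h0 := vand_Ico m (a.sum + 1)
    rw [Ico_add_succ, Finset.insert_eq, Finset.union_comm, vand_union hd0, vand_Ico, crossDist_comm,
      ← upPositions_singleton, ← hsymm, crossDist_comm] at h0
    have hv : vand {m + (a.sum : ℤ)} = 1 := by simp [vand]
    rw [h, Finset.card_union_of_disjoint hd, card_upPositions, Finset.card_singleton,
      vand_union hd, ← h0, hv, ← mul_assoc] at key
    simp only [mul_one] at key
    exact Nat.eq_of_mul_eq_mul_right (crossDist_pos hd) key

/-! ### Distances from the lobes to the extension of the axis -/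

theorem crossDist_image_add (k : ℤ) (S T : Finset ℤ) :
    crossDist (S.image (· + k)) (T.image (· + k)) = crossDist S T := by
  have hinj : Function.Injective fun p : ℤ => p + k := fun a b h => by simpa using h
  simp only [crossDist, Finset.prod_image hinj.injOn, add_sub_add_right_eq_sub]

/-- The down positions of the gapped list complement the up positions in the full interval: they are
the mirror image of the up positions and the central gap. -/
theorem lobePositions_false_gappedLobes (m : ℤ) {a : List ℕ} (ha : a ≠ []) :
    lobePositions m false (gappedLobes a) =
      ((upPositions m a).image fun p => 2 * m + 2 * a.sum - p) ∪ {m + (a.sum : ℤ)} := by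
  have h1 := lobePositions_union_not m true (gappedLobes a)
  have h2 := disjoint_lobePositions_not m true (gappedLobes a)
  have h3 := upPositions_union_image m a
  have h4 := disjoint_upPositions_image m a
  rw [lobePositions_gappedLobes m ha, sum_gappedLobes ha, Bool.not_true] at h1
  rw [lobePositions_gappedLobes m ha, Bool.not_true] at h2
  ext x
  have e1 := Finset.ext_iff.1 h1 x
  have e3 := Finset.ext_iff.1 h3 x
  have e2 : x ∈ upPositions m a → x ∉ lobePositions m false (gappedLobes a) :=
    fun h => Finset.disjoint_left.1 h2 h
  have e4 : x ∈ upPositions m a →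
      x ∉ (upPositions m a).image fun p => 2 * m + 2 * a.sum - p :=
    fun h => Finset.disjoint_left.1 h4 h
  rw [mem_fernPositions, Finset.mem_union] at e3
  rw [Finset.mem_union, Finset.mem_Ico] at e1
  rw [Finset.mem_union, Finset.mem_singleton]
  have e5 : (m ≤ x ∧ x < m + (2 * a.sum + 1 : ℕ)) ↔
      ((m ≤ x ∧ x < m + a.sum) ∨ (m + a.sum + 1 ≤ x ∧ x < m + 2 * a.sum + 1)) ∨
        x = m + a.sum := by omega
  have e6 : x = m + (a.sum : ℤ) → ¬ ((m ≤ x ∧ x < m + a.sum) ∨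
    (m + a.sum + 1 ≤ x ∧ x < m + 2 * a.sum + 1)) := by omega
  rw [e5, ← e3] at e1
  rw [← e3] at e6
  constructor
  · intro hf
    rcases e1.1 (Or.inr hf) with (hu | hi) | hc
    · exact absurd hf (e2 hu)
    · exact Or.inl hi
    · exact Or.inr hc
  · rintro (hi | hc)
    · exact (e1.2 (Or.inl (Or.inr hi))).resolve_left fun hu => e4 hu hi
    · exact (e1.2 (Or.inr hc)).resolve_left fun hu => e6 hc (Or.inl hu)

theorem gappedSum_zero (a : List ℕ) : gappedSum a 0 = 0 := by simp [gappedSum]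

theorem gappedSum_last {a : List ℕ} (ha : a ≠ []) :
    gappedSum a (2 * a.length) = 2 * a.sum + 1 := by
  rw [gappedSum, ← length_gappedLobes, List.take_length, sum_gappedLobes ha]

/-- Comparison of the distances from the up-pointing lobes to the extension of the axis with the
case of a single lobe, if the axis is extended to the left. -/
theorem crossDist_ext_left (P H : ℕ) {a : List ℕ} (ha : a ≠ []) :
    (crossDist (upPositions P a) (Finset.Ico (-H : ℤ) 0) : ℚ) /
        crossDist (upPositions P [a.sum]) (Finset.Ico (-H : ℤ) 0) =
      (hyperfactRatio H (P + a.sum))⁻¹ *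
        (∏ i ∈ Finset.range a.length, hyperfactRatio H (P + gappedSum a (2 * i + 1))) *
        ∏ i ∈ Finset.Ico 1 a.length, (hyperfactRatio H (P + gappedSum a (2 * i)))⁻¹ := by
  have h1 := (crossDist_lobePositions P H a.length (gappedLobes a) (length_gappedLobes a)).1
  have hlen : 0 < a.length := List.length_pos_iff.2 ha
  have n0 := hyperfactRatio_ne_zero H P
  have n1 := hyperfactRatio_ne_zero H (P + a.sum)
  rw [lobePositions_gappedLobes _ ha] at h1
  rw [h1, upPositions_singleton, crossDist_Ico_Ico]
  change (∏ i ∈ Finset.range a.length, hyperfactRatio H (P + gappedSum a (2 * i + 1)) /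
    hyperfactRatio H (P + gappedSum a (2 * i))) / _ = _
  simp only [div_eq_mul_inv, Finset.prod_mul_distrib]
  -- The factor with index `0` has empty partial sum and cancels against the single-lobe
  -- denominator.
  rw [← Finset.prod_range_mul_prod_Ico
    (fun i => (hyperfactRatio H (P + gappedSum a (2 * i)))⁻¹) hlen, Finset.prod_range_one,
    mul_zero, gappedSum_zero, add_zero]
  field_simp

/-- Comparison of the distances from the up-pointing lobes to the extension of the axis with the
case of a single lobe, if the axis is extended to the right. -/
theorem crossDist_ext_right (P H : ℕ) {a : List ℕ} (ha : a ≠ []) :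
    (crossDist (upPositions P a)
        (Finset.Ico (2 * P + 2 * a.sum + 1 : ℤ) (2 * P + 2 * a.sum + 1 + H)) : ℚ) /
        crossDist (upPositions P [a.sum])
          (Finset.Ico (2 * P + 2 * a.sum + 1 : ℤ) (2 * P + 2 * a.sum + 1 + H)) =
      hyperfactRatio H (P + a.sum) *
        (∏ i ∈ Finset.range a.length, (hyperfactRatio H (P + gappedSum a (2 * i + 1)))⁻¹) *
        ∏ i ∈ Finset.Ico 1 a.length, hyperfactRatio H (P + gappedSum a (2 * i)) := by
  -- Reflection moves the right extension to `[-H, 0)` and the up positions to the down positions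
  -- without the centre. The factor of the centre is the same for both lists and cancels in the
  -- quotient.
  have refl : ∀ b : List ℕ, b ≠ [] → b.sum = a.sum →
      (crossDist (upPositions P b)
        (Finset.Ico (2 * P + 2 * a.sum + 1 : ℤ) (2 * P + 2 * a.sum + 1 + H)) : ℚ) *
        crossDist {(P : ℤ) + (a.sum : ℤ)} (Finset.Ico (-H : ℤ) 0) =
      crossDist (lobePositions P false (gappedLobes b)) (Finset.Ico (-H : ℤ) 0) := by
    intro b hb hs
    have hnot : ((P : ℤ) + (b.sum : ℤ)) ∉ fernPositions P b.sum := by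
      rw [mem_fernPositions]; omega
    have hd : Disjoint ((upPositions P b).image fun p => 2 * (P : ℤ) + 2 * b.sum - p)
        {(P : ℤ) + (b.sum : ℤ)} := by
      rw [Finset.disjoint_singleton_right]
      intro h
      exact hnot (upPositions_union_image P b ▸ Finset.mem_union_right _ h)
    rw [lobePositions_false_gappedLobes _ hb, crossDist_union_left hd, Nat.cast_mul, hs]
    congr 2
    rw [← crossDist_image_sub (2 * P + 2 * a.sum : ℤ), image_sub_Ico (2 * P + 2 * a.sum : ℤ)]
    congr 2 <;> ring
  have hd0 : (crossDist {(P : ℤ) + (a.sum : ℤ)} (Finset.Ico (-H : ℤ) 0) : ℚ) ≠ 0 := by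
    refine Nat.cast_ne_zero.2 (crossDist_pos ?_).ne'
    simp [-Nat.cast_list_sum]
    omega
  have r1 := refl a ha rfl
  have r2 := refl [a.sum] (by simp) (by simp)
  have h1 := (crossDist_lobePositions P H a.length (gappedLobes a) (length_gappedLobes a)).2
  have h2 : (crossDist (lobePositions P false (gappedLobes [a.sum])) (Finset.Ico (-H : ℤ) 0) : ℚ) =
      hyperfactRatio H (P + gappedSum a (2 * a.length)) / hyperfactRatio H (P + a.sum) := by
    have e := crossDist_Ico_Ico (P + a.sum) (a.sum + 1) H
    have e' : gappedLobes [a.sum] = [a.sum, a.sum + 1] := by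
      simp [gappedLobes, doubled]
    rw [e', gappedSum_last ha]
    have e2 : P + (2 * a.sum + 1) = P + a.sum + (a.sum + 1) := by ring
    rw [e2, ← e]
    simp [lobePositions, -Nat.cast_list_sum]
  have hlen : 0 < a.length := List.length_pos_iff.2 ha
  have n1 := hyperfactRatio_ne_zero H (P + gappedSum a (2 * a.length))
  have n2 := hyperfactRatio_ne_zero H (P + a.sum)
  rw [← mul_div_mul_right _ _ hd0, r1, r2, h1, h2]
  change (∏ i ∈ Finset.range a.length, hyperfactRatio H (P + gappedSum a (2 * i + 2)) /
    hyperfactRatio H (P + gappedSum a (2 * i + 1))) / _ = _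
  -- The last factor, at the total sum `2 * a.sum + 1`, also occurs for the single lobe and cancels.
  have h3 : ∏ i ∈ Finset.range a.length, hyperfactRatio H (P + gappedSum a (2 * i + 2)) =
      (∏ i ∈ Finset.Ico 1 a.length, hyperfactRatio H (P + gappedSum a (2 * i))) *
        hyperfactRatio H (P + gappedSum a (2 * a.length)) := by
    rw [← Finset.prod_Ico_succ_top hlen
      (fun i => hyperfactRatio H (P + gappedSum a (2 * i))), Finset.prod_Ico_eq_prod_range]
    refine Finset.prod_congr (by simp) fun i _ => ?_
    congr 3
    ring
  simp only [div_eq_mul_inv, Finset.prod_mul_distrib, h3]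
  field_simp

theorem hyperfactRatio_inv (H t : ℕ) :
    (hyperfactRatio H t)⁻¹ = hyperfact t / hyperfact (t + H) := by
  rw [hyperfactRatio, inv_div]

/-- The extension is on the right for `h ≥ 0` and on the left for `h < 0`. Exchanging the sides
inverts every `hyperfactRatio`, and so does the sign of `h` in passing from `m` to `m + h`, so both
cases give one formula. -/
theorem crossDist_ext (m h : ℤ) (hm : 0 ≤ m) (hmh : 0 ≤ m + h) {a : List ℕ} (ha : a ≠ []) :
    (crossDist (extPositions m h a.sum) (upPositions m a) : ℚ) /
        crossDist (extPositions m h a.sum) (upPositions m [a.sum]) =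
      ((hyperfact ((m + h).toNat + a.sum) : ℚ) / (hyperfact (m.toNat + a.sum) : ℚ))
      * (∏ i ∈ Finset.range a.length,
          (hyperfact (m.toNat + gappedSum a (2 * i + 1)) : ℚ) /
            (hyperfact ((m + h).toNat + gappedSum a (2 * i + 1)) : ℚ))
      * (∏ i ∈ Finset.Ico 1 a.length,
          (hyperfact ((m + h).toNat + gappedSum a (2 * i)) : ℚ) /
            (hyperfact (m.toNat + gappedSum a (2 * i)) : ℚ)) := by
  rw [crossDist_comm, crossDist_comm (extPositions m h a.sum)]
  obtain ⟨H, hH | hH⟩ := h.eq_nat_or_neg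
  · obtain ⟨P, rfl⟩ := Int.eq_ofNat_of_zero_le hm
    subst hH
    have e1 : ((P : ℤ) + H).toNat = P + H := by omega
    have e2 : (P : ℤ).toNat = P := by simp
    have e3 : extPositions P H a.sum =
        Finset.Ico (2 * P + 2 * a.sum + 1 : ℤ) (2 * P + 2 * a.sum + 1 + H) := by
      simp [extPositions, extStart, -Nat.cast_list_sum]
    rw [e1, e2, e3, crossDist_ext_right P H ha]
    simp only [hyperfactRatio_inv]
    simp only [hyperfactRatio, Nat.add_right_comm _ _ H]
  · obtain ⟨P, hP⟩ := Int.eq_ofNat_of_zero_le hmh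
    obtain rfl : m = P + H := by omega
    subst hH
    have e1 : ((P : ℤ) + H + -H).toNat = P := by omega
    have e2 : ((P : ℤ) + H).toNat = P + H := by omega
    -- Translation by `H` brings the left extension `[0, H)` to `[-H, 0)`, with the base point at `P
    -- = m + h`.
    have e3 : extPositions (P + H) (-H) a.sum = (Finset.Ico (-H : ℤ) 0).image (· + (H : ℤ)) := by
      ext x
      rw [mem_extPositions, Finset.mem_image]
      simp only [Finset.mem_Ico]
      exact ⟨fun h => ⟨x - H, by omega, by ring⟩, fun ⟨y, hy, e⟩ => by omega⟩
    have e4 : ∀ b : List ℕ, b ≠ [] →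
        upPositions ((P : ℤ) + H) b = (upPositions P b).image (· + (H : ℤ)) := by
      intro b hb
      rw [← lobePositions_gappedLobes _ hb, ← lobePositions_gappedLobes _ hb,
        image_add_lobePositions]
    rw [e1, e2, e3, e4 a ha, e4 [a.sum] (by simp), crossDist_image_add, crossDist_image_add,
      crossDist_ext_left P H ha]
    simp only [hyperfactRatio_inv]
    simp only [hyperfactRatio, Nat.add_right_comm _ _ H]

end FernCored

open FernCored
-- The quotient of the two counts
theorem theorem2 (x y z : ℤ) (hx : -1 ≤ x) (hy : 0 ≤ y) (hz : 0 ≤ z)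
    (hxy : x ≡ y [ZMOD 2]) (hyz : y ≡ z [ZMOD 2]) (a : List ℕ) (ha : a ≠ []) :
    0 < fcCount x y z [a.sum] ∧
    (fcCount x y z a : ℚ) / (fcCount x y z [a.sum] : ℚ) =
      (semihexagonCount (semihexagonArgs a) : ℚ)
      * ((hyperfact (((x + z) / 2).toNat + a.sum) : ℚ) /
          (hyperfact (((x + y) / 2).toNat + a.sum) : ℚ))
      * (∏ i ∈ Finset.range a.length,
          (hyperfact (((x + y) / 2).toNat + gappedSum a (2 * i + 1)) : ℚ) /
            (hyperfact (((x + z) / 2).toNat + gappedSum a (2 * i + 1)) : ℚ))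
      * (∏ i ∈ Finset.Ico 1 a.length,
          (hyperfact (((x + z) / 2).toNat + gappedSum a (2 * i)) : ℚ) /
            (hyperfact (((x + y) / 2).toNat + gappedSum a (2 * i)) : ℚ)) := by
  unfold Int.ModEq at hxy hyz
  -- Equal parity makes `(x + y) / 2 = m` and `(z - y) / 2 = h` exact; then `(x + z) / 2 = m + h`,
  -- and `m` and `m + h` are nonnegative even for `x = -1`.
  obtain ⟨m, rfl⟩ : ∃ m, x = 2 * m - y := ⟨(x + y) / 2, by omega⟩
  obtain ⟨h, rfl⟩ : ∃ h, z = y + 2 * h := ⟨(z - y) / 2, by omega⟩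
  have hm : 0 ≤ m := by omega
  have hmh : 0 ≤ m + h := by omega
  obtain ⟨n, hn⟩ : ∃ n : ℕ, (n : ℤ) = y + h + a.sum := ⟨(y + h + a.sum).toNat, by omega⟩
  have e1 : (2 * m - y + (y + 2 * h)) / 2 = m + h := by omega
  have e2 : (2 * m - y + y) / 2 = m := by omega
  have c1 := fcCount_mul_hyperfact hx hy hz hn
  have c0 := fcCount_mul_hyperfact (a := [a.sum]) hx hy hz (by rw [List.sum_singleton]; exact hn)
  have hW := crossingWeight_pos (s := a.sum) hx hy hz hn
  rw [List.sum_singleton] at c0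
  have hd : Disjoint (extPositions m h a.sum) (upPositions m [a.sum]) := by
    have := upPositions_subset m [a.sum]
    rw [List.sum_singleton] at this
    exact (disjoint_ext_fern hm hmh a.sum).mono_right this
  have hcd := crossDist_pos hd
  have hpos : 0 < fcCount (2 * m - y) y (y + 2 * h) [a.sum] := by
    refine Nat.pos_of_mul_pos_right (b := hyperfact n) ?_
    rw [c0]
    exact Nat.mul_pos (Nat.mul_pos (vand_pos _) hcd) hW
  refine ⟨hpos, ?_⟩
  have key := crossDist_ext m h hm hmh ha
  rw [e1, e2, mul_assoc, mul_assoc, ← mul_assoc (_ / _) _ _, ← key]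
  rw [← vand_upPositions m ha] at c1
  -- For the single-lobe region the internal product of differences is `hyperfact a.sum`, the factor
  -- that also accompanies the semihexagon count.
  rw [upPositions_singleton m, vand_Ico, ← upPositions_singleton m] at c0
  have hq0 : (fcCount (2 * m - y) y (y + 2 * h) [a.sum] : ℚ) ≠ 0 := by exact_mod_cast hpos.ne'
  have hqn : (hyperfact n : ℚ) ≠ 0 := by exact_mod_cast (hyperfact_pos n).ne'
  have hqs : (hyperfact a.sum : ℚ) ≠ 0 := by exact_mod_cast (hyperfact_pos a.sum).ne'
  have hqW : (crossingWeight m h a.sum n : ℚ) ≠ 0 := by exact_mod_cast hW.ne'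
  have hqc : (crossDist (extPositions m h a.sum) (upPositions m [a.sum]) : ℚ) ≠ 0 := by
    exact_mod_cast hcd.ne'
  rw [← mul_div_mul_right _ _ hqn]
  have c1' := congrArg (Nat.cast : ℕ → ℚ) c1
  have c0' := congrArg (Nat.cast : ℕ → ℚ) c0
  simp only [Nat.cast_mul] at c1' c0'
  rw [c1', c0']
  field_simp
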